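/- Let $D(\mathbb R_+,E)$ denote the space of càdlàg functions $\mathbb R_+\to E$ with the Skorokhod ($J_1$) topology: $x_m\to x$ iff there are increasing bijections $\gamma_m$ of $\mathbb R_+$ with $\sup_{t\ge 0}|\gamma_m(t)-t|\to0$ and $\sup_{t\le T}d(x_m(\gamma_m(t)),x(t))\to0$ for every $T$. Let $\mathcal N$ be the space of locally finite simple point measures on $\mathbb R_+^2$ (sums of Dirac masses at distinct points), with the topology of vague convergence. A Poisson measure on $\mathbb R_+^2$ with Lebesgue intensity is a random measure $\pi$ such that $\pi(B)$ has the Poisson law with parameter the Lebesgue measure of $B$ for every Borel set $B$ (being a.s. infinite if this parameter is infinite), and such that $\pi(B_1),\dots,\pi(B_m)$ are independent for pairwise disjoint Borel sets $B_1,\dots,B_m$; Poisson measures are regarded as $\mathcal N$-valued random variables. **Theorem.** Let $Y^{N,k}$ and $\bar Y^k$ $(N,k\ge1)$ be $D(\mathbb R_+,\mathbb R_+)$-valued random variables, and let $(\pi^k)_{k\ge1}$ and $(\bar\pi^k)_{k\ge1}$ be two i.i.d. families of Poisson measures on $\mathbb R_+^2$ with Lebesgue intensity, the variables $Y^{N,k},\pi^k$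 being defined on one probability space and the variables $\bar Y^k,\bar\pi^k$ on another (possibly the same). Define $$Z^{N,k}_t=\int_{[0,t]\times\mathbb R_+}\mathbf 1_{\{z\le Y^{N,k}_{s-}\}}\,d\pi^k(s,z),\qquad \bar Z^k_t=\int_{[0,t]\times\mathbb R_+}\mathbf 1_{\{z\le \bar Y^k_{s-}\}}\,d\bar\pi^k(s,z),\qquad t\ge0,\ k\ge 1,$$ where $x_{0-}:=x_0$. Assume that, for every $n\ge1$, $(Y^{N,1},\pi^1,\dots,Y^{N,n},\pi^n)$ converges in distribution, as $N\to\infty$, to $(\bar Y^1,\bar\pi^1,\dots,\bar Y^n,\bar\pi^n)$ in $(D(\mathbb R_+,\mathbb R)\times\mathcal N)^n$ with the product topology, and that, for each $k\ge1$, $\bar Y^k$ is independent of $\bar\pi^k$. Then, for every $n\ge1$, $(Z^{N,k})_{1\le k\le n}$ converges in distribution to $(\bar Z^k)_{1\le k\le n}$ in $D(\mathbb R_+,\mathbb R^n)$ as $N\to\infty$. In particular, $(Z^{N,k})_{k\ge1}$ converges in distribution to $(\bar Z^k)_{k\ge1}$ in $D(\mathbb R_+,\mathbb R)^{\mathbb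 N^*}$ endowed with the product topology. -/

import Mathlib

open MeasureTheory ProbabilityTheory Filter Set
open scoped Topology NNReal ENNReal CompactlySupported

/-! ### Convergence in distribution -/

/-- Convergence in distribution of random elements of a topological space `E`, carrying its Borel
`σ`-algebra: the laws (Borel probability measures on `E`) converge weakly. -/
def TendstoInLaw {ι E Ω Ω' : Type*} [TopologicalSpace E] [MeasurableSpace Ω] [MeasurableSpace Ω']
    (X : ι → Ω → E) (l : Filter ι) (Z : Ω' → E) (P : Measure Ω) [IsProbabilityMeasure P]
    (P' : Measure Ω') [IsProbabilityMeasure P'] : Prop :=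
  letI : MeasurableSpace E := borel E
  haveI : BorelSpace E := ⟨rfl⟩
  TendstoInDistribution X l Z (fun _ => P) P'

/-! ### The Skorokhod space -/

/-- The space `D(ℝ₊, E)` of càdlàg functions: right-continuous with left limits. -/
structure SkorokhodSpace (E : Type*) [TopologicalSpace E] where
  /-- the underlying function -/
  toFun : ℝ≥0 → E
  right_continuous : ∀ t, ContinuousWithinAt toFun (Ici t) t
  left_limits : ∀ t, ∃ l, Tendsto toFun (𝓝[<] t) (𝓝 l)

namespace SkorokhodSpace

instance {E : Type*} [TopologicalSpace E] : FunLike (SkorokhodSpace E) ℝ≥0 E where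
  coe := toFun
  coe_injective := fun x y h => by cases x; cases y; congr

section Topology

variable {E : Type*} [PseudoMetricSpace E]

/-- `(x, y)` lies in `entourage E T ε` if for some time change `γ` (an increasing bijection of
`ℝ₊`, automatically continuous) we have `|γ t - t| < ε` for all `t ≥ 0` and
`dist (y (γ t)) (x t) < ε` for all `t ≤ T`. -/
def entourage (E : Type*) [PseudoMetricSpace E] (T : ℝ≥0) (ε : ℝ) :
    Set (SkorokhodSpace E × SkorokhodSpace E) :=
  {p | ∃ γ : ℝ≥0 ≃o ℝ≥0, (∀ t, dist (γ t) t < ε) ∧ ∀ t ≤ T, dist (p.2 (γ t)) (p.1 t) < ε}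

theorem entourage_mono {T T' : ℝ≥0} {ε ε' : ℝ} (hT : T' ≤ T) (hε : ε ≤ ε') :
    entourage E T ε ⊆ entourage E T' ε' := by
  rintro p ⟨γ, h1, h2⟩
  exact ⟨γ, fun t => (h1 t).trans_le hε, fun t ht => (h2 t (ht.trans hT)).trans_le hε⟩

/-- The sets `entourage E T ε`, for `T ≥ 0` and `ε > 0`, as a filter basis. -/
def entourageBasis (E : Type*) [PseudoMetricSpace E] :
    FilterBasis (SkorokhodSpace E × SkorokhodSpace E) where
  sets := {V | ∃ (T : ℝ≥0) (ε : ℝ), 0 < ε ∧ V = entourage E T ε}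
  nonempty := ⟨_, 0, 1, one_pos, rfl⟩
  inter_sets := by
    rintro _ _ ⟨T, ε, hε, rfl⟩ ⟨T', ε', hε', rfl⟩
    exact ⟨_, ⟨max T T', min ε ε', lt_min hε hε', rfl⟩, subset_inter
      (entourage_mono (le_max_left _ _) (min_le_left _ _))
      (entourage_mono (le_max_right _ _) (min_le_right _ _))⟩

theorem time_le_add_one {s t T : ℝ≥0} (h : dist s t < 1) (ht : t ≤ T) : s ≤ T + 1 := by
  rw [NNReal.dist_eq, abs_lt] at h
  have h3 : (t : ℝ) ≤ T := by exact_mod_cast ht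
  have h4 : (s : ℝ) ≤ T + 1 := by linarith
  exact_mod_cast h4

/-- The Skorokhod (J1) topology on `D(ℝ₊, E)`, presented by a uniformity. A sequence `xₙ` converges
to `x` iff there are time changes `γₙ` with `sup_t |γₙ t - t| → 0` and
`sup_{t ≤ T} dist (xₙ (γₙ t)) (x t) → 0` for every `T`. -/
instance : UniformSpace (SkorokhodSpace E) :=
  UniformSpace.ofCore <| UniformSpace.Core.mkOfBasis (entourageBasis E)
    (by
      rintro _ ⟨T, ε, hε, rfl⟩ x
      exact ⟨OrderIso.refl _, fun t => by simpa using hε, fun t _ => by simpa using hε⟩)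
    (by
      rintro _ ⟨T, ε, hε, rfl⟩
      refine ⟨_, ⟨T + 1, min ε 1, lt_min hε one_pos, rfl⟩, ?_⟩
      rintro ⟨x, y⟩ ⟨γ, h1, h2⟩
      have h3 : ∀ t, dist (γ.symm t) t < min ε 1 := fun t => by
        simpa [dist_comm] using h1 (γ.symm t)
      refine ⟨γ.symm, fun t => (h3 t).trans_le (min_le_left _ _), fun t ht => ?_⟩
      have h4 := h2 (γ.symm t) (time_le_add_one ((h3 t).trans_le (min_le_right _ _)) ht)
      rw [OrderIso.apply_symm_apply, dist_comm] at h4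
      exact h4.trans_le (min_le_left _ _))
    (by
      rintro _ ⟨T, ε, hε, rfl⟩
      refine ⟨_, ⟨T + 1, min (ε / 2) 1, lt_min (half_pos hε) one_pos, rfl⟩, ?_⟩
      rintro ⟨x, z⟩ ⟨y, ⟨γ, h1, h2⟩, ⟨γ', h1', h2'⟩⟩
      have l1 := min_le_left (ε / 2) 1
      have l2 := min_le_right (ε / 2) 1
      refine ⟨γ.trans γ', fun t => ?_, fun t ht => ?_⟩
      · have a1 := h1 t
        have a2 := h1' (γ t)
        have a3 := dist_triangle (γ' (γ t)) (γ t) t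
        simp only [OrderIso.trans_apply]
        linarith
      · have a1 := h2 t (ht.trans le_self_add)
        have a2 := h2' (γ t) (time_le_add_one ((h1 t).trans_le l2) ht)
        have a3 := dist_triangle (z (γ' (γ t))) (y (γ t)) (x t)
        simp only [OrderIso.trans_apply] at *
        linarith)

instance : MeasurableSpace (SkorokhodSpace E) := borel _

instance : BorelSpace (SkorokhodSpace E) := ⟨rfl⟩

end Topology

/-- The `D(ℝ₊, ℝⁿ)`-valued function with given coordinates in `D(ℝ₊, ℝ)`. -/
def vec {n : ℕ} (z : Fin n → SkorokhodSpace ℝ) : SkorokhodSpace (Fin n → ℝ) where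
  toFun t k := z k t
  right_continuous t := continuousWithinAt_pi.2 fun k => (z k).right_continuous t
  left_limits t := by
    choose l hl using fun k => (z k).left_limits t
    exact ⟨l, tendsto_pi_nhds.2 hl⟩

end SkorokhodSpace

/-! ### Locally finite measures, simple point measures, Poisson measures on `ℝ₊ × ℝ₊` -/

/-- The space of locally finite (Borel) measures on `ℝ₊ × ℝ₊`. -/
def LocFinMeasure : Type := {μ : Measure (ℝ≥0 × ℝ≥0) // IsLocallyFiniteMeasure μ}

namespace LocFinMeasure

/-- The underlying measure. -/
def toMeasure (μ : LocFinMeasure) : Measure (ℝ≥0 × ℝ≥0) := μ.1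

instance (μ : LocFinMeasure) : IsLocallyFiniteMeasure μ.toMeasure := μ.2

/-- The vague topology: the coarsest one making `μ ↦ ∫ f dμ` continuous for all continuous
compactly supported `f`. -/
noncomputable instance : TopologicalSpace LocFinMeasure :=
  ⨅ f : C_c(ℝ≥0 × ℝ≥0, ℝ), TopologicalSpace.induced (fun μ => ∫ p, f p ∂μ.toMeasure) inferInstance

/-- The `σ`-algebra generated by the evaluations `μ ↦ μ B`, `B` Borel. -/
instance : MeasurableSpace LocFinMeasure :=
  ⨆ (B : Set (ℝ≥0 × ℝ≥0)) (_ : MeasurableSet B),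
    MeasurableSpace.comap (fun μ => μ.toMeasure B) inferInstance

end LocFinMeasure

/-- A simple point measure: a sum of Dirac masses at pairwise distinct points. -/
def IsSimplePointMeasure (μ : Measure (ℝ≥0 × ℝ≥0)) : Prop :=
  ∃ S : Set (ℝ≥0 × ℝ≥0), μ = Measure.sum fun p : S => Measure.dirac (p : ℝ≥0 × ℝ≥0)

/-- The space of locally finite simple point measures on `ℝ₊ × ℝ₊`, with the topology and the
`σ`-algebra of a subspace of the space of locally finite measures. -/
abbrev SimplePointMeasure : Type := {μ : LocFinMeasure // IsSimplePointMeasure μ.toMeasure}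

/-- Lebesgue measure on `ℝ₊ × ℝ₊`: the measure of `B` is the Lebesgue measure of `B` seen as a
subset of `ℝ × ℝ`. -/
noncomputable def lebesgueQuadrant : Measure (ℝ≥0 × ℝ≥0) :=
  (volume : Measure (ℝ × ℝ)).comap fun p => ((p.1 : ℝ), (p.2 : ℝ))

/-- A random measure `π` on `ℝ₊ × ℝ₊` is a Poisson measure with intensity `ν` if `π B` is
Poisson with parameter `ν B` for every Borel `B` (with `π B = ∞` almost surely if `ν B = ∞`), and if
`π B₁, …, π Bₙ` are independent for all pairwise disjoint Borel sets `B₁, …, Bₙ`. -/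
structure IsPoissonMeasure {Ω : Type*} [MeasurableSpace Ω] (π : Ω → LocFinMeasure)
    (ν : Measure (ℝ≥0 × ℝ≥0)) (P : Measure Ω) : Prop where
  measurable : Measurable π
  law_of_ne_top : ∀ B, MeasurableSet B → ν B ≠ ∞ →
    P.map (fun ω => (π ω).toMeasure B) =
      (poissonMeasure (ν B).toNNReal).map (fun j : ℕ => (j : ℝ≥0∞))
  law_of_eq_top : ∀ B, MeasurableSet B → ν B = ∞ → ∀ᵐ ω ∂P, (π ω).toMeasure B = ∞
  indep : ∀ (n : ℕ) (B : Fin n → Set (ℝ≥0 × ℝ≥0)), (∀ i, MeasurableSet (B i)) →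
    Pairwise (fun i j => Disjoint (B i) (B j)) →
    iIndepFun (fun i ω => (π ω).toMeasure (B i)) P

/-! ### Thinning -/

/-- The value at time `t` of the thinning of `π` by `x`:
`∫_{[0,t] × ℝ₊} 1{z ≤ x(s-)} dπ(s,z)`, where `x(0-) = x(0)`. -/
noncomputable def thinningValue (x : SkorokhodSpace ℝ) (π : Measure (ℝ≥0 × ℝ≥0)) (t : ℝ≥0) : ℝ :=
  ∫ p in Iic t ×ˢ univ,
    indicator {p : ℝ≥0 × ℝ≥0 | (p.2 : ℝ) ≤ Function.leftLim x p.1} (fun _ => (1 : ℝ)) p ∂π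

theorem SkorokhodSpace.exists_bound (x : SkorokhodSpace ℝ) (T : ℝ≥0) :
    ∃ C : ℝ, ∀ t ∈ Icc 0 T, x t ≤ C := by
  refine isCompact_Icc.induction_on (p := fun s => ∃ C : ℝ, ∀ t ∈ s, x t ≤ C) ?_ ?_ ?_ ?_
  · exact ⟨0, by simp⟩
  · rintro s t hst ⟨C, hC⟩
    exact ⟨C, fun u hu => hC u (hst hu)⟩
  · rintro s t ⟨C, hC⟩ ⟨C', hC'⟩
    refine ⟨max C C', ?_⟩
    rintro u (hu | hu)
    · exact (hC u hu).trans (le_max_left _ _)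
    · exact (hC' u hu).trans (le_max_right _ _)
  · intro t _
    obtain ⟨l, hl⟩ := x.left_limits t
    have h1 : ∀ᶠ u in 𝓝[<] t, x u ≤ l + 1 := hl.eventually_le_const (by linarith)
    have h2 : ∀ᶠ u in 𝓝[≥] t, x u ≤ x t + 1 :=
      Tendsto.eventually_le_const (show x t < x t + 1 by linarith) (x.right_continuous t)
    have h3 : ∀ᶠ u in 𝓝 t, x u ≤ max (l + 1) (x t + 1) := by
      rw [← nhdsLT_sup_nhdsGE]
      exact eventually_sup.2 ⟨h1.mono fun u hu => hu.trans (le_max_left _ _),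
        h2.mono fun u hu => hu.trans (le_max_right _ _)⟩
    exact ⟨_, mem_nhdsWithin_of_mem_nhds h3, _, fun u hu => hu⟩

theorem SkorokhodSpace.exists_bound_leftLim (x : SkorokhodSpace ℝ) (T : ℝ≥0) :
    ∃ C : ℝ, ∀ t ≤ T, Function.leftLim x t ≤ C := by
  obtain ⟨C, hC⟩ := x.exists_bound T
  refine ⟨C, fun t ht => ?_⟩
  by_cases h : 𝓝[<] t = ⊥
  · rw [leftLim_eq_of_eq_bot _ h]
    exact hC t ⟨zero_le, ht⟩
  · have : (𝓝[<] t).NeBot := ⟨h⟩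
    refine le_of_tendsto (tendsto_leftLim_of_tendsto (x.left_limits t)) ?_
    filter_upwards [self_mem_nhdsWithin] with u hu
    exact hC u ⟨zero_le, (le_of_lt hu).trans ht⟩

/-- The points of `[0, t] × ℝ₊` below the graph of `s ↦ x(s-)`. -/
def thinningSet (x : SkorokhodSpace ℝ) (t : ℝ≥0) : Set (ℝ≥0 × ℝ≥0) :=
  {p | p.1 ≤ t ∧ (p.2 : ℝ) ≤ Function.leftLim x p.1}

theorem measure_thinningSet_ne_top (x : SkorokhodSpace ℝ) (π : LocFinMeasure) (t : ℝ≥0) :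
    π.toMeasure (thinningSet x t) ≠ ∞ := by
  obtain ⟨C, hC⟩ := x.exists_bound_leftLim t
  have h : thinningSet x t ⊆ Icc 0 t ×ˢ Icc 0 C.toNNReal := fun p hp =>
    ⟨⟨zero_le, hp.1⟩, ⟨zero_le, by
      rw [← NNReal.coe_le_coe]
      exact (hp.2.trans (hC _ hp.1)).trans (Real.le_coe_toNNReal C)⟩⟩
  exact ((measure_mono h).trans_lt (isCompact_Icc.prod isCompact_Icc).measure_lt_top).ne

theorem SimplePointMeasure.nullMeasurableSet (π : SimplePointMeasure) (A : Set (ℝ≥0 × ℝ≥0)) :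
    NullMeasurableSet A π.1.toMeasure := by
  obtain ⟨S, hS⟩ := π.2
  have hK : ∀ K, IsCompact K → (S ∩ K).Finite := by
    intro K hK
    have h1 : π.1.toMeasure K < ∞ := hK.measure_lt_top
    rw [hS, Measure.sum_apply _ hK.measurableSet] at h1
    have h2 := ENNReal.finite_const_le_of_tsum_ne_top h1.ne one_ne_zero
    refine (h2.image Subtype.val).subset ?_
    rintro p ⟨hp, hpK⟩
    refine ⟨⟨p, hp⟩, ?_, rfl⟩
    simp [hpK]
  have hSc : S.Countable := by
    have h : S = ⋃ n, S ∩ compactCovering (ℝ≥0 × ℝ≥0) n := by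
      rw [← inter_iUnion, iUnion_compactCovering, inter_univ]
    rw [h]
    exact countable_iUnion fun n => (hK _ (isCompact_compactCovering _ n)).countable
  have h0 : π.1.toMeasure Sᶜ = 0 := by
    rw [hS, Measure.sum_apply _ hSc.measurableSet.compl]
    simp
  rw [← inter_union_sdiff A S]
  exact ((hSc.mono inter_subset_right).measurableSet.nullMeasurableSet).union
    (NullMeasurableSet.of_null (measure_mono_null (fun p hp => hp.2) h0))

/-- The thinning counts the atoms in `thinningSet x t`. -/
theorem thinningValue_eq (x : SkorokhodSpace ℝ) (π : SimplePointMeasure) (t : ℝ≥0) :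
    thinningValue x π.1.toMeasure t = π.1.toMeasure.real (thinningSet x t) := by
  have hA := π.nullMeasurableSet {p : ℝ≥0 × ℝ≥0 | (p.2 : ℝ) ≤ Function.leftLim x p.1}
  rw [thinningValue, integral_indicator₀ (hA.mono_ac Measure.absolutelyContinuous_restrict),
    setIntegral_const, smul_eq_mul, mul_one, measureReal_def, measureReal_def,
    Measure.restrict_apply₀ (hA.mono_ac Measure.absolutelyContinuous_restrict)]
  congr 2
  ext p
  simp [thinningSet, and_comm]

/-- The thinning `t ↦ ∫_{[0,t] × ℝ₊} 1{z ≤ x(s-)} dπ(s,z)` as an element of `D(ℝ₊, ℝ)`. -/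
noncomputable def thinning (x : SkorokhodSpace ℝ) (π : SimplePointMeasure) : SkorokhodSpace ℝ where
  toFun := thinningValue x π.1.toMeasure
  right_continuous t := by
    have h0 : ∀ t, thinningValue x π.1.toMeasure t
        = (π.1.toMeasure (thinningSet x t)).toReal := thinningValue_eq x π
    rw [← continuousWithinAt_Ioi_iff_Ici]
    have h1 := tendsto_measure_biInter_gt (μ := π.1.toMeasure) (s := thinningSet x) (a := t)
      (fun r _ => π.nullMeasurableSet _) (fun i j _ hij p hp => ⟨hp.1.trans hij, hp.2⟩)
      ⟨t + 1, by simp, measure_thinningSet_ne_top x π.1 _⟩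
    have h2 : ⋂ r > t, thinningSet x r = thinningSet x t := by
      ext p
      simp only [thinningSet, mem_iInter, mem_ofPred_eq]
      refine ⟨fun h => ⟨le_of_forall_gt_imp_ge_of_dense fun r hr => (h r hr).1,
        (h (t + 1) (by simp)).2⟩, fun h r hr => ⟨h.1.trans (le_of_lt hr), h.2⟩⟩
    rw [h2] at h1
    rw [ContinuousWithinAt, funext h0]
    exact (ENNReal.tendsto_toReal (measure_thinningSet_ne_top x π.1 t)).comp h1
  left_limits t := by
    have h0 : ∀ t, thinningValue x π.1.toMeasure t
        = (π.1.toMeasure (thinningSet x t)).toReal := thinningValue_eq x π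
    have hm : Monotone (thinningValue x π.1.toMeasure) := fun r s hrs => by
      rw [h0, h0]
      exact ENNReal.toReal_mono (measure_thinningSet_ne_top x π.1 s)
        (measure_mono fun p hp => ⟨hp.1.trans hrs, hp.2⟩)
    exact ⟨_, hm.tendsto_nhdsLT t⟩

/-!
The thinning `(x, μ) ↦ (t ↦ μ {(s, z) | s ≤ t, z ≤ x (s-)})` is not continuous, but it is continuous
at almost every realization of the limit, and the theorem is an instance of the mapping theorem.

*Continuity* (`IsRegularConfiguration.tendsto_vec_thinning`). Suppose that no atom of the limiting
point measures lies on the completed graph of the corresponding path, that no atom has time `0`, and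
that all the atoms, of all the measures together, have distinct times. In a large rectangle there
are finitely many atoms; under vague convergence each of them is the limit of exactly one atom of
the approximating measures, on the same side of the paths, and there are no other atoms. A time change
taking the times of the limiting atoms to those of the approximating ones then makes the vector of
thinnings equal to its limit on a bounded interval. It has to be common to all coordinates, which is
possible as the times are distinct (`SkorokhodSpace.exists_time_change`).

*Regularity* (`ae_isRegularConfiguration`). The completed graph of a càdlàg path has zero area, so
an independent Poisson measure does not charge it. Two atoms share their time with probability zero,
since a Poisson measure has two atoms in a strip of area `a`, or two independent ones have an atom
each there, with probability at most `a ^ 2`, and a square is cut into `O(m)` strips of area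
`O(1 / m)`.

*Mapping theorem* (`TendstoInLaw.of_ae_tendsto`). It rests on the bound for closed sets in the
portmanteau theorem, which requires a metrizable source space. Instead of metrizing the vague
topology, the point measures are mapped to their integrals against countably many test functions;
these determine the convergence of the atoms (`SimplePointMeasure.testIntegrals`).

*Measurability* (`SkorokhodSpace.measurable_pi_of_eval`). The approximating thinnings have to be
Borel random elements of the Skorokhod space, although their paths and point measures may depend on
each other. A càdlàg function is the limit of its samplings along finer and finer grids, which depend
continuously on countably many of its values; so measurability of the values suffices, and these are
measures of sections of a measurable set (`LocFinMeasure.measurable_section`).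

The convergence of the infinite sequence follows from that of its finite parts, as a closed set in a
countable product is the intersection of the cylinders over the closures of its finite-dimensional
projections (`TendstoInLaw.of_forall_fin`).
-/

open scoped Uniformity

/-! ### The Skorokhod topology -/

namespace SkorokhodSpace

section Topology

variable {E : Type*} [PseudoMetricSpace E]

theorem hasBasis_uniformity :
    (𝓤 (SkorokhodSpace E)).HasBasis (fun p : ℝ≥0 × ℝ => 0 < p.2)
      (fun p => entourage E p.1 p.2) := by
  refine ⟨fun t => ?_⟩
  refine (entourageBasis E).mem_filter_iff.trans ⟨?_, ?_⟩
  · rintro ⟨_, ⟨T, ε, hε, rfl⟩, h⟩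
    exact ⟨(T, ε), hε, h⟩
  · rintro ⟨⟨T, ε⟩, hε, h⟩
    exact ⟨_, ⟨T, ε, hε, rfl⟩, h⟩

theorem hasBasis_nhds (x : SkorokhodSpace E) :
    (𝓝 x).HasBasis (fun p : ℝ≥0 × ℝ => 0 < p.2)
      (fun p => {y | (x, y) ∈ entourage E p.1 p.2}) :=
  nhds_basis_uniformity' hasBasis_uniformity

theorem entourage_mem_nhds (x : SkorokhodSpace E) (T : ℝ≥0) {ε : ℝ} (hε : 0 < ε) :
    {y | (x, y) ∈ entourage E T ε} ∈ 𝓝 x :=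
  (hasBasis_nhds x).mem_of_mem (i := (T, ε)) hε

instance : (𝓤 (SkorokhodSpace E)).IsCountablyGenerated := by
  have h : (𝓤 (SkorokhodSpace E)).HasBasis (fun _ : ℕ => True)
      (fun n => entourage E n (1 / ((n : ℝ) + 1))) := by
    refine hasBasis_uniformity.to_hasBasis ?_ fun n _ =>
      ⟨(n, 1 / ((n : ℝ) + 1)), Nat.one_div_pos_of_nat, subset_rfl⟩
    rintro ⟨T, ε⟩ hε
    obtain ⟨m, hm⟩ := exists_nat_ge T
    obtain ⟨k, hk⟩ := exists_nat_one_div_lt (K := ℝ) hε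
    refine ⟨max m k, trivial, entourage_mono (hm.trans (by exact_mod_cast le_max_left m k)) ?_⟩
    refine le_trans (one_div_le_one_div_of_le (by positivity) ?_) hk.le
    gcongr
    exact le_max_right m k
  exact h.isCountablyGenerated

/-- A small perturbation of finitely many times, fixing `0`, extends to a time change that is
uniformly close to the identity, namely `t ↦ t + ∑ (φ f - f) h_f t` with narrow tents `h_f`. -/
theorem exists_time_change (F : Finset ℝ≥0) {ε : ℝ} (hε : 0 < ε) :
    ∃ δ > 0, ∀ φ : ℝ≥0 → ℝ≥0, φ 0 = 0 → (∀ f ∈ F, dist (φ f) f < δ) →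
      ∃ γ : ℝ≥0 ≃o ℝ≥0, (∀ t, dist (γ t) t < ε) ∧ ∀ f ∈ F, γ f = φ f := by
  obtain ⟨F', hF'⟩ : ∃ F', F' = insert 0 F := ⟨_, rfl⟩
  obtain ⟨η, hη, hsep⟩ : ∃ η : ℝ, 0 < η ∧ ∀ f ∈ F', ∀ f' ∈ F', f ≠ f' → η ≤ dist f f' := by
    have h : ∀ᶠ η : ℝ in 𝓝[>] 0, ∀ f ∈ F', ∀ f' ∈ F', f ≠ f' → η ≤ dist f f' := by
      refine (eventually_all_finset _).2 fun f _ => (eventually_all_finset _).2 fun f' _ => ?_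
      by_cases hff : f = f'
      · simp [hff]
      · have : ∀ᶠ η : ℝ in 𝓝 0, η < dist f f' := eventually_lt_nhds (dist_pos.2 hff)
        filter_upwards [mem_nhdsWithin_of_mem_nhds this] with η hη _ using le_of_lt hη
    obtain ⟨η, h1, h2⟩ := (h.and self_mem_nhdsWithin).exists
    exact ⟨η, h2, h1⟩
  set c : ℝ := (F'.card : ℝ) with hc
  have hc0 : 0 ≤ c := by positivity
  refine ⟨min ε η / (c + 1), by positivity, fun φ hφ0 hφF => ?_⟩
  set δ : ℝ := min ε η / (c + 1) with hδ
  have hδ0 : 0 < δ := by positivity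
  have hcδ : c * δ < min ε η := by
    rw [hδ, mul_div_assoc', div_lt_iff₀ (by positivity)]
    have : 0 < min ε η := by positivity
    nlinarith
  have hφ : ∀ f ∈ F', |(φ f : ℝ) - f| ≤ δ := by
    intro f hf
    rw [hF', Finset.mem_insert] at hf
    rcases hf with rfl | hf
    · simpa [hφ0] using hδ0.le
    · have := hφF f hf
      rw [NNReal.dist_eq] at this
      exact this.le
  -- tent functions of width `η` centred at the points of `F'`
  let h : ℝ≥0 → ℝ≥0 → ℝ := fun f t => max (1 - |(t : ℝ) - f| / η) 0
  have h_lip : ∀ f s t, |h f t - h f s| ≤ |(t : ℝ) - s| / η := by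
    intro f s t
    refine (abs_max_sub_max_le_abs _ _ _).trans ?_
    have : (1 - |(t : ℝ) - f| / η) - (1 - |(s : ℝ) - f| / η)
        = (|(s : ℝ) - f| - |(t : ℝ) - f|) / η := by ring
    rw [this, abs_div, abs_of_pos hη]
    refine div_le_div_of_nonneg_right ?_ hη.le
    refine (abs_abs_sub_abs_le_abs_sub _ _).trans (le_of_eq ?_)
    rw [abs_sub_comm]
    congr 1
    ring
  have h_le : ∀ f t, |h f t| ≤ 1 := by
    intro f t
    rw [abs_of_nonneg (le_max_right _ _)]
    refine max_le ?_ zero_le_one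
    have : 0 ≤ |(t : ℝ) - f| / η := by positivity
    linarith
  have h_self : ∀ f, h f f = 1 := by intro f; simp [h]
  have h_ne : ∀ f ∈ F', ∀ f' ∈ F', f ≠ f' → h f f' = 0 := by
    intro f hf f' hf' hne
    refine max_eq_right ?_
    have := hsep f' hf' f hf hne.symm
    rw [NNReal.dist_eq] at this
    have := (one_le_div hη).2 this
    linarith
  let g : ℝ≥0 → ℝ := fun t => t + ∑ f ∈ F', ((φ f : ℝ) - f) * h f t
  have g_F : ∀ f ∈ F', g f = φ f := by
    intro f hf
    simp only [g]
    rw [Finset.sum_eq_single f (fun f' hf' hne => by rw [h_ne f' hf' f hf hne, mul_zero])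
      (fun hf' => absurd hf hf'), h_self]
    ring
  have g_close : ∀ t, |g t - t| < ε := by
    intro t
    simp only [g, add_sub_cancel_left]
    refine (Finset.abs_sum_le_sum_abs _ _).trans_lt ?_
    refine (Finset.sum_le_sum (g := fun _ => δ) fun f hf => ?_).trans_lt ?_
    · rw [abs_mul]
      simpa using mul_le_mul (hφ f hf) (h_le f t) (abs_nonneg _) hδ0.le
    · rw [Finset.sum_const, nsmul_eq_mul]
      exact hcδ.trans_le (min_le_left _ _)
  have g_mono : StrictMono g := by
    intro s t hst
    have hst' : (s : ℝ) < t := by exact_mod_cast hst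
    have h1 : |∑ f ∈ F', ((φ f : ℝ) - f) * (h f t - h f s)| ≤ c * (δ * ((t - s) / η)) := by
      refine (Finset.abs_sum_le_sum_abs _ _).trans ?_
      refine (Finset.sum_le_sum (g := fun _ => δ * ((t - s) / η)) fun f hf => ?_).trans ?_
      · rw [abs_mul]
        refine mul_le_mul (hφ f hf) ?_ (abs_nonneg _) hδ0.le
        simpa [abs_of_pos (sub_pos.2 hst')] using h_lip f s t
      · rw [Finset.sum_const, nsmul_eq_mul]
    have h2 : c * (δ * ((t - s) / η)) < t - s := by
      have : c * (δ * ((t - s) / η)) = (c * δ) / η * (t - s) := by ring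
      rw [this]
      have h3 : c * δ / η < 1 := (div_lt_one hη).2 (hcδ.trans_le (min_le_right _ _))
      nlinarith [sub_pos.2 hst']
    have h3 : g t - g s = (t - s) + ∑ f ∈ F', ((φ f : ℝ) - f) * (h f t - h f s) := by
      simp only [g, mul_sub, Finset.sum_sub_distrib]
      ring
    have h4 := neg_abs_le (∑ f ∈ F', ((φ f : ℝ) - f) * (h f t - h f s))
    linarith
  have g_zero : g 0 = 0 := by
    rw [g_F 0 (by simp [hF'])]
    simp [hφ0]
  have g_nonneg : ∀ t, 0 ≤ g t := fun t => g_zero ▸ g_mono.monotone zero_le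
  have g_cont : Continuous g := by
    simp only [g, h]
    fun_prop
  let G : ℝ≥0 → ℝ≥0 := fun t => ⟨g t, g_nonneg t⟩
  have G_cont : Continuous G := g_cont.subtype_mk _
  have G_mono : StrictMono G := fun s t hst => g_mono hst
  have G_surj : Function.Surjective G := by
    intro u
    have h1 : G 0 = 0 := NNReal.eq g_zero
    refine mem_range_of_exists_le_of_exists_ge G_cont ⟨0, by simp [h1]⟩ ⟨u + ε.toNNReal, ?_⟩
    rw [← NNReal.coe_le_coe]
    have := (abs_lt.1 (g_close (u + ε.toNNReal))).1
    simp only [NNReal.coe_add, Real.coe_toNNReal _ hε.le] at this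
    change (u : ℝ) ≤ g (u + ε.toNNReal)
    linarith
  refine ⟨G_mono.orderIsoOfSurjective G G_surj, fun t => ?_, fun f hf => ?_⟩
  · rw [NNReal.dist_eq]
    exact g_close t
  · exact NNReal.eq (g_F f (by simp [hF', hf]))

/-! ### Approximation by step functions -/

/-- Càdlàg functions oscillate little between the points of a suitable finite set. -/
theorem exists_finset_dist_lt (x : SkorokhodSpace E) (T : ℝ≥0) {ε : ℝ} (hε : 0 < ε) :
    ∃ F : Finset ℝ≥0, ∀ s ≤ T, ∀ t, (∀ f ∈ F, f ≤ s ↔ f ≤ t) → dist (x s) (x t) < ε := by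
  suffices h : ∃ F : Finset ℝ≥0, ∀ s ∈ Icc 0 T, ∀ t, (∀ f ∈ F, f ≤ s ↔ f ≤ t) →
      dist (x s) (x t) < ε by
    obtain ⟨F, hF⟩ := h
    exact ⟨F, fun s hs => hF s ⟨zero_le, hs⟩⟩
  refine isCompact_Icc.induction_on
    (p := fun A => ∃ F : Finset ℝ≥0, ∀ s ∈ A, ∀ t, (∀ f ∈ F, f ≤ s ↔ f ≤ t) →
      dist (x s) (x t) < ε) ⟨∅, by simp⟩ ?_ ?_ ?_
  · rintro A B hAB ⟨F, hF⟩
    exact ⟨F, fun s hs => hF s (hAB hs)⟩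
  · rintro A B ⟨F, hF⟩ ⟨F', hF'⟩
    classical
    refine ⟨F ∪ F', ?_⟩
    rintro s (hs | hs) t h
    · exact hF s hs t fun f hf => h f (Finset.mem_union_left _ hf)
    · exact hF' s hs t fun f hf => h f (Finset.mem_union_right _ hf)
  · intro u _
    obtain ⟨l, hl⟩ := x.left_limits u
    have h1 : ∀ᶠ v in 𝓝[<] u, dist (x v) l < ε / 2 := hl (Metric.ball_mem_nhds l (half_pos hε))
    have h2 : ∀ᶠ v in 𝓝[≥] u, dist (x v) (x u) < ε / 2 :=
      x.right_continuous u (Metric.ball_mem_nhds (x u) (half_pos hε))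
    obtain ⟨b, hb, hub⟩ := (mem_nhdsGE_iff_exists_Ico_subset' (lt_add_one u)).1 h2
    have key : ∀ s t : ℝ≥0, s ∈ Ico u b → t ∈ Ico u b → dist (x s) (x t) < ε := by
      intro s t hs ht
      have := dist_triangle_right (x s) (x t) (x u)
      have h3 : dist (x s) (x u) < ε / 2 := hub hs
      have h4 : dist (x t) (x u) < ε / 2 := hub ht
      linarith
    rcases eq_or_lt_of_le (zero_le (a := u)) with rfl | hu
    · refine ⟨Iio b, mem_nhdsWithin_of_mem_nhds (Iio_mem_nhds hb), {b}, fun s hs t h => ?_⟩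
      have h3 := h b (by simp)
      have h4 : t < b := not_le.1 fun h5 => (not_le.2 hs) (h3.2 h5)
      exact key s t ⟨zero_le, hs⟩ ⟨zero_le, h4⟩
    · obtain ⟨a', ha', hau⟩ := (mem_nhdsLT_iff_exists_Ioo_subset' hu).1 h1
      obtain ⟨a, haa, hau'⟩ := exists_between (mem_Iio.1 ha')
      refine ⟨Ioo a b, mem_nhdsWithin_of_mem_nhds (Ioo_mem_nhds hau' hb), {a, u, b},
        fun s hs t h => ?_⟩
      have h3 := h a (by simp)
      have h4 := h u (by simp)
      have h5 := h b (by simp)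
      have h6 : t < b := not_le.1 fun h7 => (not_le.2 hs.2) (h5.2 h7)
      have h7 : a ≤ t := h3.1 hs.1.le
      rcases le_or_gt u s with h8 | h8
      · exact key s t ⟨h8, hs.2⟩ ⟨h4.1 h8, h6⟩
      · have h9 : t < u := not_le.1 fun h9 => (not_le.2 h8) (h4.2 h9)
        have := dist_triangle_right (x s) (x t) l
        have h10 : dist (x s) l < ε / 2 := hau ⟨haa.trans hs.1, h8⟩
        have h11 : dist (x t) l < ε / 2 := hau ⟨haa.trans_le h7, h9⟩
        linarith

/-- The càdlàg step function with value `a i` on `[i / (j + 1), (i + 1) / (j + 1))`. -/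
noncomputable def step (j : ℕ) (a : ℕ → E) : SkorokhodSpace E where
  toFun t := a ⌊((j : ℝ≥0) + 1) * t⌋₊
  right_continuous t := by
    have hc : Continuous fun u : ℝ≥0 => ((j : ℝ≥0) + 1) * u := by fun_prop
    have h : ∀ᶠ u in 𝓝[≥] t, ⌊((j : ℝ≥0) + 1) * u⌋₊ = ⌊((j : ℝ≥0) + 1) * t⌋₊ := by
      have h1 : ∀ᶠ u in 𝓝 t, ((j : ℝ≥0) + 1) * u < (⌊((j : ℝ≥0) + 1) * t⌋₊ : ℝ≥0) + 1 :=
        hc.continuousAt.eventually_lt_const (Nat.lt_floor_add_one _)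
      filter_upwards [mem_nhdsWithin_of_mem_nhds h1, self_mem_nhdsWithin] with u hu hut
      refine (Nat.floor_eq_iff zero_le).2 ⟨(Nat.floor_le zero_le).trans ?_, hu⟩
      gcongr
      exact hut
    exact tendsto_const_nhds.congr' (h.mono fun u hu => (congrArg a hu).symm)
  left_limits t := by
    have hc : Continuous fun u : ℝ≥0 => ((j : ℝ≥0) + 1) * u := by fun_prop
    refine ⟨a (⌈(j + 1) * t⌉₊ - 1), ?_⟩
    have h : ∀ᶠ u in 𝓝[<] t, ⌊((j : ℝ≥0) + 1) * u⌋₊ = ⌈((j : ℝ≥0) + 1) * t⌉₊ - 1 := by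
      rcases eq_or_lt_of_le (zero_le (a := t)) with rfl | ht
      · filter_upwards [self_mem_nhdsWithin] with u hu
        exact absurd (mem_Iio.1 hu) not_lt_zero
      have h0 : 0 < ⌈((j : ℝ≥0) + 1) * t⌉₊ := Nat.ceil_pos.2 (by positivity)
      have h1 : ∀ᶠ u in 𝓝 t, ((⌈((j : ℝ≥0) + 1) * t⌉₊ - 1 : ℕ) : ℝ≥0) < (j + 1) * u :=
        hc.continuousAt.eventually_const_lt (Nat.lt_ceil.1 (Nat.sub_one_lt h0.ne'))
      filter_upwards [mem_nhdsWithin_of_mem_nhds h1, self_mem_nhdsWithin] with u hu hut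
      refine (Nat.floor_eq_iff zero_le).2 ⟨hu.le, ?_⟩
      have h2 : ((⌈((j : ℝ≥0) + 1) * t⌉₊ - 1 : ℕ) : ℝ≥0) + 1 = ⌈((j : ℝ≥0) + 1) * t⌉₊ := by
        exact_mod_cast Nat.sub_add_cancel h0
      rw [h2]
      refine lt_of_lt_of_le ?_ (Nat.le_ceil _)
      have : u < t := hut
      gcongr
    exact tendsto_const_nhds.congr' (h.mono fun u hu => (congrArg a hu).symm)

theorem step_apply (j : ℕ) (a : ℕ → E) (t : ℝ≥0) : step j a t = a ⌊((j : ℝ≥0) + 1) * t⌋₊ := rfl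

theorem continuous_step (j : ℕ) : Continuous (step j : (ℕ → E) → SkorokhodSpace E) := by
  refine continuous_iff_continuousAt.2 fun a => ?_
  refine (hasBasis_nhds (step j a)).tendsto_right_iff.2 ?_
  rintro ⟨T, ε⟩ hε
  have h : ∀ᶠ b in 𝓝 a, ∀ i ∈ Finset.range (⌊((j : ℝ≥0) + 1) * T⌋₊ + 1), dist (b i) (a i) < ε :=
    (eventually_all_finset _).2 fun i _ =>
      (continuous_apply i).continuousAt (Metric.ball_mem_nhds (a i) hε)
  filter_upwards [h] with b hb
  refine ⟨OrderIso.refl _, fun t => by simpa using hε, fun t ht => ?_⟩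
  simp only [OrderIso.refl_apply, step_apply]
  refine hb _ (Finset.mem_range.2 (Nat.lt_succ_of_le (Nat.floor_mono ?_)))
  gcongr

/-- Sampling a càdlàg function along finer and finer grids recovers it in the limit. -/
theorem tendsto_step (x : SkorokhodSpace E) :
    Tendsto (fun j : ℕ => step j fun i => x ((i : ℝ≥0) / (j + 1))) atTop (𝓝 x) := by
  refine (hasBasis_nhds x).tendsto_right_iff.2 ?_
  rintro ⟨T, ε⟩ hε
  obtain ⟨F, hF⟩ := exists_finset_dist_lt x T hε
  obtain ⟨δ, hδ, hγ⟩ := exists_time_change F hε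
  obtain ⟨k, hk⟩ := exists_nat_one_div_lt (K := ℝ) hδ
  filter_upwards [eventually_ge_atTop k] with j hj
  have hj0 : (0 : ℝ≥0) < j + 1 := by positivity
  have hjδ : 1 / ((j : ℝ) + 1) < δ := (one_div_le_one_div_of_le (by positivity)
    (by gcongr)).trans_lt hk
  -- each point of `F` is moved to the first grid point after it
  obtain ⟨γ, hγ1, hγ2⟩ := hγ (fun f => ⌈((j : ℝ≥0) + 1) * f⌉₊ / (j + 1)) (by simp) fun f _ => by
    have h1 : f ≤ ⌈((j : ℝ≥0) + 1) * f⌉₊ / (j + 1) := by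
      rw [le_div_iff₀ hj0, mul_comm]
      exact Nat.le_ceil _
    have h2 : ⌈((j : ℝ≥0) + 1) * f⌉₊ / (j + 1) ≤ f + 1 / (j + 1) := by
      rw [div_le_iff₀ hj0, add_mul f, one_div_mul_cancel hj0.ne', mul_comm f]
      exact (Nat.ceil_lt_add_one zero_le).le
    rw [NNReal.dist_eq, abs_of_nonneg (sub_nonneg.2 (NNReal.coe_le_coe.2 h1))]
    have h3 := NNReal.coe_le_coe.2 h2
    push_cast at h3 ⊢
    linarith
  refine ⟨γ, hγ1, fun t ht => ?_⟩
  rw [dist_comm, step_apply]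
  refine hF t ht _ fun f hf => ?_
  rw [← γ.le_iff_le, hγ2 f hf, div_le_iff₀ hj0, le_div_iff₀ hj0, mul_comm (γ t),
    ← Nat.le_floor_iff zero_le, Nat.ceil_le, mul_comm f]

/-- A family of random càdlàg functions is measurable for the Borel `σ`-algebra of the product of
the Skorokhod spaces as soon as all its values are measurable. -/
theorem measurable_pi_of_eval {Ω ι : Type*} [MeasurableSpace Ω] [Countable ι]
    [MeasurableSpace E] [BorelSpace E] [SecondCountableTopology E]
    {X : Ω → ι → SkorokhodSpace E} (hX : ∀ k t, Measurable fun ω => X ω k t) :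
    Measurable[_, borel (ι → SkorokhodSpace E)] X := by
  let : MeasurableSpace (ι → SkorokhodSpace E) := borel _
  have : BorelSpace (ι → SkorokhodSpace E) := ⟨rfl⟩
  let S : ℕ → (ι → ℕ → E) → ι → SkorokhodSpace E := fun j a k => step j (a k)
  have hS : ∀ j, Continuous (S j) := fun j =>
    continuous_pi fun k => (continuous_step j).comp (continuous_apply k)
  refine measurable_of_tendsto_metrizable
    (f := fun j ω => S j fun k i => X ω k ((i : ℝ≥0) / (j + 1))) (fun j => ?_) ?_
  · have h : Measurable fun ω => fun (k : ι) (i : ℕ) => X ω k ((i : ℝ≥0) / (j + 1)) :=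
      measurable_pi_lambda _ fun k => measurable_pi_lambda _ fun i => hX k _
    exact (hS j).measurable.comp h
  · exact tendsto_pi_nhds.2 fun ω => tendsto_pi_nhds.2 fun k => tendsto_step (X ω k)

theorem measurable_of_eval {Ω : Type*} [MeasurableSpace Ω]
    [MeasurableSpace E] [BorelSpace E] [SecondCountableTopology E]
    {X : Ω → SkorokhodSpace E} (hX : ∀ t, Measurable fun ω => X ω t) : Measurable X := by
  have h := measurable_pi_of_eval (ι := Unit) (X := fun ω _ => X ω) fun _ t => hX t
  let : MeasurableSpace (Unit → SkorokhodSpace E) := borel _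
  have : BorelSpace (Unit → SkorokhodSpace E) := ⟨rfl⟩
  exact (continuous_apply ()).measurable.comp h

/-- The `k`-th coordinate of an `ℝⁿ`-valued càdlàg function. -/
def coord {n : ℕ} (k : Fin n) (z : SkorokhodSpace (Fin n → ℝ)) : SkorokhodSpace ℝ where
  toFun t := z t k
  right_continuous t := continuousWithinAt_pi.1 (z.right_continuous t) k
  left_limits t := by
    obtain ⟨l, hl⟩ := z.left_limits t
    exact ⟨l k, tendsto_pi_nhds.1 hl k⟩

theorem continuous_coord {n : ℕ} (k : Fin n) : Continuous (coord k) := by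
  refine continuous_iff_continuousAt.2 fun z => ?_
  refine (hasBasis_nhds (coord k z)).tendsto_right_iff.2 ?_
  rintro ⟨T, ε⟩ hε
  filter_upwards [entourage_mem_nhds z T hε] with y ⟨γ, h1, h2⟩
  exact ⟨γ, h1, fun t ht => (dist_le_pi_dist _ _ k).trans_lt (h2 t ht)⟩

end Topology

end SkorokhodSpace

/-! ### Atoms of simple point measures -/

namespace SimplePointMeasure

/-- The set of atoms of a simple point measure. -/
def atoms (μ : SimplePointMeasure) : Set (ℝ≥0 × ℝ≥0) := {p | μ.1.toMeasure {p} ≠ 0}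

theorem toMeasure_eq_sum (μ : SimplePointMeasure) :
    μ.1.toMeasure = Measure.sum fun p : μ.atoms => Measure.dirac (p : ℝ≥0 × ℝ≥0) := by
  obtain ⟨S, hS⟩ := μ.2
  have h : μ.atoms = S := by
    ext p
    simp only [atoms, mem_ofPred_eq, hS, Measure.sum_apply _ (measurableSet_singleton p), ne_eq,
      ENNReal.tsum_eq_zero, not_forall]
    constructor
    · rintro ⟨q, hq⟩
      have : (q : ℝ≥0 × ℝ≥0) = p := by
        by_contra hne
        exact hq (by simp [hne])
      exact this ▸ q.2
    · intro hp
      exact ⟨⟨p, hp⟩, by simp⟩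
  rw [h, hS]

theorem toMeasure_apply_of_measurableSet (μ : SimplePointMeasure) {A : Set (ℝ≥0 × ℝ≥0)}
    (hA : MeasurableSet A) : μ.1.toMeasure A = (μ.atoms ∩ A).encard := by
  conv_lhs => rw [toMeasure_eq_sum, Measure.sum_apply _ hA]
  rw [← ENNReal.tsum_set_one, tsum_subtype μ.atoms (fun p => Measure.dirac p A),
    tsum_subtype (μ.atoms ∩ A) (fun _ => 1)]
  refine tsum_congr fun p => ?_
  by_cases h1 : p ∈ μ.atoms <;> by_cases h2 : p ∈ A <;> simp [h1, h2]

theorem finite_atoms_inter (μ : SimplePointMeasure) {K : Set (ℝ≥0 × ℝ≥0)} (hK : IsCompact K) :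
    (μ.atoms ∩ K).Finite := by
  have h : μ.1.toMeasure K < ∞ := hK.measure_lt_top
  rw [μ.toMeasure_apply_of_measurableSet hK.measurableSet] at h
  rw [← Set.encard_ne_top_iff]
  intro h'
  simp [h'] at h

theorem finite_atoms_inter_ball (μ : SimplePointMeasure) (p : ℝ≥0 × ℝ≥0) (η : ℝ) :
    (μ.atoms ∩ Metric.ball p η).Finite :=
  (μ.finite_atoms_inter (isCompact_closedBall p η)).subset
    (inter_subset_inter_right _ Metric.ball_subset_closedBall)

theorem countable_atoms (μ : SimplePointMeasure) : μ.atoms.Countable := by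
  have h : μ.atoms = ⋃ n, μ.atoms ∩ compactCovering (ℝ≥0 × ℝ≥0) n := by
    rw [← inter_iUnion, iUnion_compactCovering, inter_univ]
  rw [h]
  exact countable_iUnion fun n => (μ.finite_atoms_inter (isCompact_compactCovering _ n)).countable

/-- A simple point measure counts the atoms in arbitrary sets, measurable or not. -/
theorem toMeasure_apply (μ : SimplePointMeasure) (A : Set (ℝ≥0 × ℝ≥0)) :
    μ.1.toMeasure A = (μ.atoms ∩ A).encard := by
  have h1 : MeasurableSet (μ.atoms ∩ A) := (μ.countable_atoms.mono inter_subset_left).measurableSet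
  have h2 : μ.1.toMeasure μ.atomsᶜ = 0 := by
    rw [μ.toMeasure_apply_of_measurableSet μ.countable_atoms.measurableSet.compl]
    simp
  have h3 : μ.1.toMeasure A = μ.1.toMeasure (μ.atoms ∩ A) := by
    refine le_antisymm ?_ (measure_mono inter_subset_right)
    calc μ.1.toMeasure A ≤ μ.1.toMeasure ((μ.atoms ∩ A) ∪ μ.atomsᶜ) :=
          measure_mono fun p hp => (em (p ∈ μ.atoms)).imp (fun h => ⟨h, hp⟩) id
      _ ≤ _ := (measure_union_le _ _).trans (by rw [h2, add_zero])
  rw [h3, μ.toMeasure_apply_of_measurableSet h1, ← inter_assoc, inter_self]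

theorem real_apply (μ : SimplePointMeasure) (A : Set (ℝ≥0 × ℝ≥0)) :
    μ.1.toMeasure.real A = (μ.atoms ∩ A).ncard := by
  rw [measureReal_def, toMeasure_apply, Set.ncard]
  cases (μ.atoms ∩ A).encard <;> simp

theorem exists_ball_inter_atoms_subset (μ : SimplePointMeasure) (p : ℝ≥0 × ℝ≥0) :
    ∃ η > 0, μ.atoms ∩ Metric.ball p η ⊆ {p} := by
  have hfin := (μ.finite_atoms_inter (isCompact_closedBall p 1)).sdiff (t := {p})
  obtain ⟨η, hη, hsub⟩ := Metric.isOpen_iff.1 hfin.isClosed.isOpen_compl p (by simp)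
  refine ⟨min η 1, by positivity, fun q hq => ?_⟩
  by_contra hqp
  exact hsub (Metric.ball_subset_ball (min_le_left _ _) hq.2)
    ⟨⟨hq.1, Metric.ball_subset_closedBall (Metric.ball_subset_ball (min_le_right _ _) hq.2)⟩, hqp⟩

/-! ### Vague convergence through countably many test functions -/

/-- A compactly supported continuous function between the indicators of the closed balls of radius
`1 / (n + 1)` and `2 / (n + 1)` around `q`. -/
noncomputable def plateau (q : ℝ≥0 × ℝ≥0) (n : ℕ) : C_c(ℝ≥0 × ℝ≥0, ℝ) where
  toFun p := min 1 (max 0 (2 - (n + 1) * dist p q))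
  continuous_toFun := by fun_prop
  hasCompactSupport' := by
    refine HasCompactSupport.intro (isCompact_closedBall q (2 / (n + 1))) fun p hp => ?_
    rw [Metric.mem_closedBall, not_le, div_lt_iff₀' (by positivity)] at hp
    rw [max_eq_left (by linarith), min_eq_right zero_le_one]

theorem plateau_apply (q : ℝ≥0 × ℝ≥0) (n : ℕ) (p : ℝ≥0 × ℝ≥0) :
    plateau q n p = min 1 (max 0 (2 - (n + 1) * dist p q)) := rfl

theorem integrable_plateau (μ : SimplePointMeasure) (q : ℝ≥0 × ℝ≥0) (n : ℕ) :
    Integrable (plateau q n) μ.1.toMeasure :=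
  (plateau q n).continuous.integrable_of_hasCompactSupport (plateau q n).hasCompactSupport

theorem ncard_le_integral_plateau (μ : SimplePointMeasure) (q : ℝ≥0 × ℝ≥0) (n : ℕ) :
    ((μ.atoms ∩ Metric.closedBall q (1 / (n + 1))).ncard : ℝ) ≤
      ∫ p, plateau q n p ∂μ.1.toMeasure := by
  have h := mul_meas_ge_le_integral_of_nonneg (μ := μ.1.toMeasure) (f := plateau q n)
    (Eventually.of_forall fun p => le_min zero_le_one (le_max_left _ _))
    (integrable_plateau μ q n) 1
  rw [one_mul, real_apply] at h
  convert h using 5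
  ext p
  rw [Metric.mem_closedBall, le_div_iff₀' (by positivity), mem_ofPred_eq, plateau_apply, le_min_iff,
    le_max_iff]
  constructor
  · intro h
    exact ⟨le_rfl, Or.inr (by linarith)⟩
  · rintro ⟨-, h | h⟩ <;> linarith

theorem integral_plateau_le_ncard (μ : SimplePointMeasure) (q : ℝ≥0 × ℝ≥0) (n : ℕ) :
    ∫ p, plateau q n p ∂μ.1.toMeasure ≤
      (μ.atoms ∩ Metric.closedBall q (2 / (n + 1))).ncard := by
  rw [← real_apply, ← integral_indicator_one Metric.isClosed_closedBall.measurableSet]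
  refine integral_mono (integrable_plateau μ q n) ?_ fun p => ?_
  · exact (integrable_indicator_iff Metric.isClosed_closedBall.measurableSet).2
      (integrableOn_const (isCompact_closedBall q _).measure_lt_top.ne)
  · rw [plateau_apply]
    by_cases hp : p ∈ Metric.closedBall q (2 / (n + 1))
    · simp [hp]
    · rw [indicator_of_notMem hp]
      rw [Metric.mem_closedBall, not_le, div_lt_iff₀' (by positivity)] at hp
      rw [max_eq_left (by linarith), min_eq_right zero_le_one]

/-- The integrals of countably many test functions against a simple point measure. Their
convergence is implied by vague convergence, takes place in a metrizable space, and still controls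
the atoms. -/
noncomputable def testIntegrals (μ : SimplePointMeasure) (i : ℕ × ℕ) : ℝ :=
  ∫ p, plateau (TopologicalSpace.denseSeq _ i.1) i.2 p ∂μ.1.toMeasure

theorem continuous_testIntegrals : Continuous testIntegrals := by
  refine continuous_pi fun i => ?_
  have h : Continuous fun μ : LocFinMeasure =>
      ∫ p, plateau (TopologicalSpace.denseSeq _ i.1) i.2 p ∂μ.toMeasure :=
    continuous_iInf_dom (i := plateau (TopologicalSpace.denseSeq _ i.1) i.2) continuous_induced_dom
  exact h.comp continuous_subtype_val

/-- Some test function lies between the indicators of two balls around `p`, so that its integral is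
between the numbers of atoms in them. -/
theorem exists_testIntegrals_bounds (p : ℝ≥0 × ℝ≥0) {η : ℝ} (hη : 0 < η) :
    ∃ ρ > 0, ∃ i : ℕ × ℕ, ∀ μ : SimplePointMeasure,
      ((μ.atoms ∩ Metric.ball p ρ).ncard : ℝ) ≤ μ.testIntegrals i ∧
      μ.testIntegrals i ≤ (μ.atoms ∩ Metric.ball p η).ncard := by
  obtain ⟨n, hn⟩ := exists_nat_one_div_lt (K := ℝ) (show 0 < η / 3 by positivity)
  have hn0 : (0 : ℝ) < 1 / (n + 1) := Nat.one_div_pos_of_nat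
  obtain ⟨k, hk⟩ := (TopologicalSpace.denseRange_denseSeq (ℝ≥0 × ℝ≥0)).exists_dist_lt p hn0
  refine ⟨1 / (n + 1) - dist p (TopologicalSpace.denseSeq _ k), by linarith, (k, n),
    fun μ => ⟨?_, ?_⟩⟩
  · refine le_trans ?_ (ncard_le_integral_plateau μ _ n)
    refine Nat.cast_le.2 (Set.ncard_le_ncard (inter_subset_inter_right _ ?_)
      (μ.finite_atoms_inter (isCompact_closedBall _ _)))
    exact Metric.ball_subset_closedBall.trans (Metric.closedBall_subset_closedBall' (by simp))
  · refine (integral_plateau_le_ncard μ _ n).trans ?_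
    refine Nat.cast_le.2 (Set.ncard_le_ncard (inter_subset_inter_right _ ?_)
      (μ.finite_atoms_inter_ball p η))
    refine Metric.closedBall_subset_ball' ?_
    rw [dist_comm]
    have : (2 : ℝ) / (n + 1) = 2 * (1 / (n + 1)) := by ring
    linarith

section Convergence

variable {ι : Type*} {l : Filter ι} {ν : ι → SimplePointMeasure} {μ : SimplePointMeasure}

theorem eventually_ncard_le (h : Tendsto (fun m => (ν m).testIntegrals) l (𝓝 μ.testIntegrals))
    (p : ℝ≥0 × ℝ≥0) {η : ℝ} (hη : 0 < η) :
    ∃ ρ > 0, ∀ᶠ m in l,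
      ((ν m).atoms ∩ Metric.ball p ρ).ncard ≤ (μ.atoms ∩ Metric.ball p η).ncard := by
  obtain ⟨ρ, hρ, i, hi⟩ := exists_testIntegrals_bounds p hη
  refine ⟨ρ, hρ, ?_⟩
  filter_upwards [(tendsto_pi_nhds.1 h i).eventually_lt_const
    (show _ < ((μ.atoms ∩ Metric.ball p η).ncard : ℝ) + 1 by linarith [(hi μ).2])] with m hm
  have := (hi (ν m)).1.trans_lt hm
  exact Nat.lt_succ_iff.1 (by exact_mod_cast this)

theorem eventually_subsingleton
    (h : Tendsto (fun m => (ν m).testIntegrals) l (𝓝 μ.testIntegrals)) (p : ℝ≥0 × ℝ≥0) :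
    ∃ ρ > 0, ∀ᶠ m in l, ((ν m).atoms ∩ Metric.ball p ρ).Subsingleton := by
  obtain ⟨η, hη, hsub⟩ := μ.exists_ball_inter_atoms_subset p
  obtain ⟨ρ, hρ, hm⟩ := eventually_ncard_le h p hη
  refine ⟨ρ, hρ, hm.mono fun m hm => ?_⟩
  have h1 := hm.trans (Set.ncard_le_ncard hsub)
  rw [Set.ncard_singleton] at h1
  intro a ha b hb
  exact (Set.ncard_le_one (finite_atoms_inter_ball _ _ _)).1 h1 a ha b hb

theorem eventually_nonempty
    (h : Tendsto (fun m => (ν m).testIntegrals) l (𝓝 μ.testIntegrals)) {p : ℝ≥0 × ℝ≥0}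
    (hp : p ∈ μ.atoms) {η : ℝ} (hη : 0 < η) :
    ∀ᶠ m in l, ((ν m).atoms ∩ Metric.ball p η).Nonempty := by
  obtain ⟨ρ, hρ, i, hi⟩ := exists_testIntegrals_bounds p hη
  have h1 : 0 < (μ.atoms ∩ Metric.ball p ρ).ncard :=
    (Set.ncard_pos (finite_atoms_inter_ball _ _ _)).2 ⟨p, hp, Metric.mem_ball_self hρ⟩
  have h2 : (0 : ℝ) < μ.testIntegrals i := lt_of_lt_of_le (by exact_mod_cast h1) (hi μ).1
  filter_upwards [(tendsto_pi_nhds.1 h i).eventually_const_lt h2] with m hm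
  refine (Set.ncard_pos (finite_atoms_inter_ball _ _ _)).1 ?_
  exact_mod_cast hm.trans_le (hi (ν m)).2

theorem eventually_disjoint
    (h : Tendsto (fun m => (ν m).testIntegrals) l (𝓝 μ.testIntegrals)) {K : Set (ℝ≥0 × ℝ≥0)}
    (hK : IsCompact K) (hμ : Disjoint μ.atoms K) : ∀ᶠ m in l, Disjoint (ν m).atoms K := by
  refine hK.induction_on (p := fun A => ∀ᶠ m in l, Disjoint (ν m).atoms A) ?_ ?_ ?_ ?_
  · simp
  · intro A B hAB hB
    exact hB.mono fun m hm => hm.mono_right hAB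
  · intro A B hA hB
    filter_upwards [hA, hB] with m h1 h2 using disjoint_union_right.2 ⟨h1, h2⟩
  · intro p hp
    obtain ⟨η, hη, hsub⟩ := μ.exists_ball_inter_atoms_subset p
    have h0 : μ.atoms ∩ Metric.ball p η = ∅ := by
      refine eq_empty_of_forall_notMem fun q hq => ?_
      have : q = p := hsub hq
      exact disjoint_left.1 hμ hq.1 (this ▸ hp)
    obtain ⟨ρ, hρ, hm⟩ := eventually_ncard_le h p hη
    refine ⟨Metric.ball p ρ, mem_nhdsWithin_of_mem_nhds (Metric.ball_mem_nhds p hρ),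
      hm.mono fun m hm => ?_⟩
    rw [h0, Set.ncard_empty, Nat.le_zero, Set.ncard_eq_zero (finite_atoms_inter_ball _ _ _)] at hm
    exact disjoint_iff_inter_eq_empty.2 hm

end Convergence

end SimplePointMeasure

/-! ### Continuity of the thinning -/

namespace SkorokhodSpace

theorem leftLim_mem_of_eventually_mem {C : Set ℝ} (hC : IsClosed C) (x : SkorokhodSpace ℝ) {t : ℝ≥0}
    (h : ∀ᶠ u in 𝓝 t, x u ∈ C) : Function.leftLim x t ∈ C := by
  by_cases ht : 𝓝[<] t = ⊥
  · rw [leftLim_eq_of_eq_bot _ ht]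
    exact h.self_of_nhds
  · have : (𝓝[<] t).NeBot := ⟨ht⟩
    exact hC.mem_of_tendsto (tendsto_leftLim_of_tendsto (x.left_limits t))
      (h.filter_mono nhdsWithin_le_nhds)

theorem leftLim_mem_of_forall_mem {C : Set ℝ} (hC : IsClosed C) (x : SkorokhodSpace ℝ) {t : ℝ≥0}
    (h : ∀ u ≤ t, x u ∈ C) : Function.leftLim x t ∈ C := by
  by_cases ht : 𝓝[<] t = ⊥
  · rw [leftLim_eq_of_eq_bot _ ht]
    exact h t le_rfl
  · have : (𝓝[<] t).NeBot := ⟨ht⟩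
    refine hC.mem_of_tendsto (tendsto_leftLim_of_tendsto (x.left_limits t)) ?_
    filter_upwards [self_mem_nhdsWithin] with u hu using h u (le_of_lt hu)

theorem eventually_leftLim_le (x : SkorokhodSpace ℝ) (T : ℝ≥0) :
    ∃ C : ℝ, ∀ᶠ y : SkorokhodSpace ℝ in 𝓝 x, ∀ t ≤ T, Function.leftLim y t ≤ C := by
  obtain ⟨C, hC⟩ := x.exists_bound (T + 1)
  refine ⟨C + 1, ?_⟩
  filter_upwards [entourage_mem_nhds x (T + 1) one_pos] with y ⟨γ, h1, h2⟩ t ht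
  refine leftLim_mem_of_forall_mem isClosed_Iic y fun u hu => ?_
  have h3 : γ.symm u ≤ T + 1 := time_le_add_one
    (by simpa [dist_comm] using h1 (γ.symm u)) (hu.trans ht)
  have h4 := h2 _ h3
  rw [OrderIso.apply_symm_apply, Real.dist_eq] at h4
  have h5 := hC (γ.symm u) ⟨zero_le, h3⟩
  have h6 := le_abs_self (y u - x (γ.symm u))
  simp only [mem_Iic]
  simp only at h4
  linarith

/-- The point `p` is at a positive distance from the completed graph of `x`, the union over `t` of
the vertical segments joining `x (t-)` to `x t`. -/
def Avoids (x : SkorokhodSpace ℝ) (p : ℝ≥0 × ℝ≥0) : Prop :=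
  ∃ η > 0, (∀ u, dist u p.1 < η → (p.2 : ℝ) + η ≤ x u) ∨ (∀ u, dist u p.1 < η → x u ≤ p.2 - η)

/-- If `p` is off the completed graph of `x`, then all points near `p` lie on the same side of the
left-limit graph of `y` as `p` does for `x`, for all paths `y` close to `x`. -/
theorem Avoids.eventually_le_leftLim_iff {x : SkorokhodSpace ℝ} {p : ℝ≥0 × ℝ≥0}
    (h : x.Avoids p) : ∃ ρ > 0, ∀ᶠ y : SkorokhodSpace ℝ in 𝓝 x, ∀ q ∈ Metric.ball p ρ,
      ((q.2 : ℝ) ≤ Function.leftLim y q.1 ↔ (p.2 : ℝ) ≤ Function.leftLim x p.1) := by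
  obtain ⟨η, hη, h⟩ := h
  have hη4 : 0 < η / 4 := by positivity
  refine ⟨η / 4, hη4, ?_⟩
  filter_upwards [entourage_mem_nhds x (p.1 + η.toNNReal) hη4] with y ⟨γ, h1, h2⟩ q hq
  have hq1 : dist q.1 p.1 < η / 4 := (le_max_left _ _).trans_lt hq
  have hq2 : |(q.2 : ℝ) - p.2| < η / 4 := (le_max_right _ _).trans_lt hq
  obtain ⟨hq3, hq4⟩ := abs_lt.1 hq2
  have hnear : ∀ {r : ℝ}, 0 < r → ∀ t : ℝ≥0, ∀ᶠ u in 𝓝 t, dist u t < r := fun hr t =>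
    Metric.ball_mem_nhds t hr
  -- near `q.1`, the values of `y` are close to values of `x` near `p.1`
  have key : ∀ u, dist u q.1 < η / 4 → ∃ v, dist v p.1 < η ∧ |y u - x v| < η / 4 := by
    intro u hu
    have h3 : dist u (γ.symm u) < η / 4 := by simpa using h1 (γ.symm u)
    have h4 : dist (γ.symm u) p.1 < η := by
      have h5 := dist_triangle_left (γ.symm u) p.1 u
      have h6 := dist_triangle u q.1 p.1
      linarith
    refine ⟨γ.symm u, h4, ?_⟩
    have h5 : γ.symm u ≤ p.1 + η.toNNReal := by
      rw [← NNReal.coe_le_coe, NNReal.coe_add, Real.coe_toNNReal _ hη.le]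
      rw [NNReal.dist_eq] at h4
      linarith [le_abs_self ((γ.symm u : ℝ) - p.1)]
    simpa [Real.dist_eq] using h2 _ h5
  rcases h with h | h
  · refine iff_of_true ?_ ?_
    · have h3 : Function.leftLim y q.1 ∈ Ici ((p.2 : ℝ) + η / 2) := by
        refine leftLim_mem_of_eventually_mem isClosed_Ici y ((hnear hη4 q.1).mono fun u hu => ?_)
        obtain ⟨v, hv, hyv⟩ := key u hu
        have := h v hv
        simp only [mem_Ici]
        linarith [(abs_lt.1 hyv).1]
      simp only [mem_Ici] at h3
      linarith
    · have h3 : Function.leftLim x p.1 ∈ Ici ((p.2 : ℝ) + η) :=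
        leftLim_mem_of_eventually_mem isClosed_Ici x ((hnear hη p.1).mono h)
      simp only [mem_Ici] at h3
      linarith
  · refine iff_of_false ?_ ?_
    · have h3 : Function.leftLim y q.1 ∈ Iic ((p.2 : ℝ) - η / 2) := by
        refine leftLim_mem_of_eventually_mem isClosed_Iic y ((hnear hη4 q.1).mono fun u hu => ?_)
        obtain ⟨v, hv, hyv⟩ := key u hu
        have := h v hv
        simp only [mem_Iic]
        linarith [(abs_lt.1 hyv).2]
      simp only [mem_Iic] at h3
      linarith
    · have h3 : Function.leftLim x p.1 ∈ Iic ((p.2 : ℝ) - η) :=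
        leftLim_mem_of_eventually_mem isClosed_Iic x ((hnear hη p.1).mono h)
      simp only [mem_Iic] at h3
      linarith

end SkorokhodSpace

open SkorokhodSpace SimplePointMeasure

theorem thinning_apply (x : SkorokhodSpace ℝ) (μ : SimplePointMeasure) (t : ℝ≥0) :
    thinning x μ t = (μ.atoms ∩ thinningSet x t).ncard :=
  (thinningValue_eq x μ t).trans (real_apply μ _)

/-- The configurations at which the thinning map is continuous: no atom lies on the completed graph
of the corresponding path, no atom has time coordinate `0`, and all the atoms of all the point
measures have distinct time coordinates. -/
structure IsRegularConfiguration {n : ℕ} (x : Fin n → SkorokhodSpace ℝ)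
    (μ : Fin n → SimplePointMeasure) : Prop where
  avoids : ∀ k, ∀ p ∈ (μ k).atoms, (x k).Avoids p
  time_ne_zero : ∀ k, ∀ p ∈ (μ k).atoms, p.1 ≠ 0
  time_injective : ∀ k l, ∀ p ∈ (μ k).atoms, ∀ q ∈ (μ l).atoms, p.1 = q.1 → k = l ∧ p = q

/-- The thinning map is continuous at regular configurations. Each atom of the limit in a large
rectangle is the limit of exactly one atom of the approximations, and both lie on the same side of
the paths. A time change matching the times of these finitely many atoms makes the approximating
thinnings equal to the limit on a given bounded interval. -/
theorem IsRegularConfiguration.tendsto_vec_thinning {n : ℕ} {x : Fin n → SkorokhodSpace ℝ}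
    {μ : Fin n → SimplePointMeasure} (hreg : IsRegularConfiguration x μ)
    {ι : Type*} {l : Filter ι} {y : ι → Fin n → SkorokhodSpace ℝ}
    {ν : ι → Fin n → SimplePointMeasure} (hy : ∀ k, Tendsto (fun m => y m k) l (𝓝 (x k)))
    (hν : ∀ k, Tendsto (fun m => (ν m k).testIntegrals) l (𝓝 (μ k).testIntegrals)) :
    Tendsto (fun m => vec fun k => thinning (y m k) (ν m k)) l
      (𝓝 (vec fun k => thinning (x k) (μ k))) := by
  refine (hasBasis_nhds _).tendsto_right_iff.2 ?_
  rintro ⟨T, ε⟩ hε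
  simp only at hε
  have hε1 : 0 < min ε 1 := by positivity
  choose C hC using fun k => (x k).eventually_leftLim_le (T + 1)
  let R : Fin n → Set (ℝ≥0 × ℝ≥0) := fun k => Icc 0 (T + 1) ×ˢ Icc 0 (C k).toNNReal
  have hR : ∀ k, IsCompact (R k) := fun k => isCompact_Icc.prod isCompact_Icc
  let A : Fin n → Set (ℝ≥0 × ℝ≥0) := fun k => (μ k).atoms ∩ R k
  have hA : ∀ k, (A k).Finite := fun k => (μ k).finite_atoms_inter (hR k)
  have hsubR : ∀ k (z : SkorokhodSpace ℝ), (∀ t ≤ T + 1, Function.leftLim z t ≤ C k) →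
      ∀ t ≤ T + 1, thinningSet z t ⊆ R k := by
    intro k z hz t ht p hp
    refine ⟨⟨zero_le, hp.1.trans ht⟩, zero_le, ?_⟩
    rw [← NNReal.coe_le_coe]
    exact (hp.2.trans (hz _ (hp.1.trans ht))).trans (Real.le_coe_toNNReal _)
  -- a radius at which the atoms near `p` are unique and on the same side of the path as `p`
  have hρ : ∀ k p, ∃ ρ > 0, p ∈ A k →
      (∀ᶠ m in l, ((ν m k).atoms ∩ Metric.ball p ρ).Subsingleton) ∧
      ∀ᶠ m in l, ∀ q ∈ Metric.ball p ρ,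
        ((q.2 : ℝ) ≤ Function.leftLim (y m k) q.1 ↔ (p.2 : ℝ) ≤ Function.leftLim (x k) p.1) := by
    intro k p
    by_cases hp : p ∈ A k
    · obtain ⟨ρ₁, hρ₁, h₁⟩ := eventually_subsingleton (hν k) p
      obtain ⟨ρ₂, hρ₂, h₂⟩ := (hreg.avoids k p hp.1).eventually_le_leftLim_iff
      refine ⟨min ρ₁ ρ₂, by positivity, fun _ => ⟨?_, ?_⟩⟩
      · exact h₁.mono fun m hm => hm.anti
          (inter_subset_inter_right _ (Metric.ball_subset_ball (min_le_left _ _)))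
      · exact ((hy k).eventually h₂).mono fun m hm q hq =>
          hm q (Metric.ball_subset_ball (min_le_right _ _) hq)
    · exact ⟨1, one_pos, fun h => absurd h hp⟩
  choose ρ hρ0 hρ using hρ
  obtain ⟨δ, hδ, hγ⟩ := exists_time_change
    (Finset.univ.biUnion fun k => (hA k).toFinset.image Prod.fst) hε1
  have e1 : ∀ᶠ m in l, ∀ k, ∀ p ∈ A k, ((ν m k).atoms ∩ Metric.ball p (ρ k p)).Subsingleton :=
    eventually_all.2 fun k => (eventually_all_finite (hA k)).2 fun p hp => (hρ k p hp).1
  have e2 : ∀ᶠ m in l, ∀ k, ∀ p ∈ A k,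
      ((ν m k).atoms ∩ Metric.ball p (min (ρ k p) δ)).Nonempty :=
    eventually_all.2 fun k => (eventually_all_finite (hA k)).2 fun p hp =>
      eventually_nonempty (hν k) hp.1 (lt_min (hρ0 k p) hδ)
  have e3 : ∀ᶠ m in l, ∀ k, Disjoint (ν m k).atoms (R k \ ⋃ p ∈ A k, Metric.ball p (ρ k p)) := by
    refine eventually_all.2 fun k => eventually_disjoint (hν k)
      ((hR k).diff (isOpen_biUnion fun p _ => Metric.isOpen_ball)) ?_
    refine disjoint_left.2 fun p hp hp' => hp'.2 ?_
    exact mem_biUnion (show p ∈ A k from ⟨hp, hp'.1⟩) (Metric.mem_ball_self (hρ0 k p))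
  have e4 : ∀ᶠ m in l, ∀ k, ∀ p ∈ A k, ∀ q ∈ Metric.ball p (ρ k p),
      ((q.2 : ℝ) ≤ Function.leftLim (y m k) q.1 ↔ (p.2 : ℝ) ≤ Function.leftLim (x k) p.1) :=
    eventually_all.2 fun k => (eventually_all_finite (hA k)).2 fun p hp => (hρ k p hp).2
  have e5 : ∀ᶠ m in l, ∀ k, ∀ t ≤ T + 1, Function.leftLim (y m k) t ≤ C k :=
    eventually_all.2 fun k => (hy k).eventually (hC k)
  filter_upwards [e1, e2, e3, e4, e5] with m h1 h2 h3 h4 h5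
  -- `π k p` is the atom of the approximation close to the atom `p`
  have hπ : ∀ k p, ∃ q, p ∈ A k → q ∈ (ν m k).atoms ∧ q ∈ Metric.ball p (min (ρ k p) δ) := by
    intro k p
    by_cases hp : p ∈ A k
    · obtain ⟨q, hq⟩ := h2 k p hp
      exact ⟨q, fun _ => hq⟩
    · exact ⟨p, fun h => absurd h hp⟩
  choose π hπ using hπ
  have hπρ : ∀ k, ∀ p ∈ A k, π k p ∈ Metric.ball p (ρ k p) := fun k p hp =>
    Metric.ball_subset_ball (min_le_left _ _) (hπ k p hp).2
  classical
  let φ : ℝ≥0 → ℝ≥0 := fun f =>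
    if h : ∃ q : Fin n × (ℝ≥0 × ℝ≥0), q.2 ∈ A q.1 ∧ q.2.1 = f then
      (π h.choose.1 h.choose.2).1 else 0
  have hφ : ∀ k, ∀ p ∈ A k, φ p.1 = (π k p).1 := by
    intro k p hp
    have h : ∃ q : Fin n × (ℝ≥0 × ℝ≥0), q.2 ∈ A q.1 ∧ q.2.1 = p.1 := ⟨(k, p), hp, rfl⟩
    obtain ⟨hk, hp'⟩ := hreg.time_injective _ _ _ h.choose_spec.1.1 _ hp.1 h.choose_spec.2
    simp only [φ, dif_pos h]
    rw [hp', hk]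
  obtain ⟨γ, hγ1, hγ2⟩ := hγ φ
    (dif_neg fun ⟨q, hq1, hq2⟩ => hreg.time_ne_zero _ _ hq1.1 hq2) (by
      intro f hf
      simp only [Finset.mem_biUnion, Finset.mem_univ, true_and, Finset.mem_image,
        Set.Finite.mem_toFinset] at hf
      obtain ⟨k, p, hp, rfl⟩ := hf
      rw [hφ k p hp]
      exact (le_max_left _ _).trans_lt
        (Metric.ball_subset_ball (min_le_right _ _) (hπ k p hp).2))
  have hγA : ∀ k, ∀ p ∈ A k, γ p.1 = (π k p).1 := by
    intro k p hp
    rw [← hφ k p hp]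
    refine hγ2 _ ?_
    simp only [Finset.mem_biUnion, Finset.mem_univ, true_and, Finset.mem_image,
      Set.Finite.mem_toFinset]
    exact ⟨k, p, hp, rfl⟩
  refine ⟨γ, fun t => (hγ1 t).trans_le (min_le_left _ _), fun t ht => ?_⟩
  have hγt : γ t ≤ T + 1 := time_le_add_one ((hγ1 t).trans_le (min_le_right _ _)) ht
  suffices h : ∀ k, thinning (y m k) (ν m k) (γ t) = thinning (x k) (μ k) t by
    have h' : (vec fun k => thinning (y m k) (ν m k)) (γ t) =
        (vec fun k => thinning (x k) (μ k)) t := funext h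
    simpa [h'] using hε
  intro k
  rw [thinning_apply, thinning_apply, Nat.cast_inj]
  have hsub : (μ k).atoms ∩ thinningSet (x k) t ⊆ A k := inter_subset_inter_right _
    (hsubR k (x k) (hC k).self_of_nhds t (ht.trans le_self_add))
  refine (Set.ncard_congr (fun p _ => π k p) ?_ ?_ ?_).symm
  · intro p hp
    have hpA := hsub hp
    refine ⟨(hπ k p hpA).1, ?_, (h4 k p hpA _ (hπρ k p hpA)).2 hp.2.2⟩
    rw [← hγA k p hpA]
    exact γ.monotone hp.2.1
  · intro p q hp hq hpq
    have h6 : γ p.1 = γ q.1 := by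
      rw [hγA k p (hsub hp), hγA k q (hsub hq), hpq]
    exact (hreg.time_injective k k p hp.1 q hq.1 (γ.injective h6)).2
  · intro q hq
    have hqR : q ∈ R k := hsubR k (y m k) (h5 k) (γ t) hγt hq.2
    have hqb : q ∈ ⋃ p ∈ A k, Metric.ball p (ρ k p) := by
      by_contra hqb
      exact disjoint_left.1 (h3 k) hq.1 ⟨hqR, hqb⟩
    obtain ⟨p, hp, hqp⟩ := mem_iUnion₂.1 hqb
    have hπq : π k p = q := h1 k p hp ⟨(hπ k p hp).1, hπρ k p hp⟩ ⟨hq.1, hqp⟩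
    refine ⟨p, ⟨hp.1, ?_, (h4 k p hp q hqp).1 hq.2.2⟩, hπq⟩
    rw [← γ.le_iff_le, hγA k p hp, hπq]
    exact hq.2.1

/-! ### Measurability -/

namespace SkorokhodSpace

theorem isOpen_setOf_exists_gt (a b : ℝ≥0) (c : ℝ) :
    IsOpen {x : SkorokhodSpace ℝ | ∃ s ∈ Ioo a b, c < x s} := by
  refine isOpen_iff_mem_nhds.2 fun x ⟨s, hs, hcs⟩ => ?_
  obtain ⟨ε, hε, hεs⟩ := Metric.isOpen_iff.1 isOpen_Ioo s hs
  filter_upwards [entourage_mem_nhds x s (lt_min hε (sub_pos.2 hcs))] with y ⟨γ, h1, h2⟩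
  refine ⟨γ s, hεs ((h1 s).trans_le (min_le_left _ _)), ?_⟩
  have := ((h2 s le_rfl).trans_le (min_le_right _ _))
  rw [Real.dist_eq] at this
  have := neg_abs_le (y (γ s) - x s)
  simp only at *
  linarith

/-- Evaluations are Borel although not continuous: by right continuity `c ≤ x t` means that `x`
takes values larger than `c - δ` right after `t`, for all `δ > 0`, which is a countable intersection
of open conditions on `x`. -/
theorem measurable_eval (t : ℝ≥0) : Measurable fun x : SkorokhodSpace ℝ => x t := by
  refine measurable_of_Ici fun c => ?_
  have h : (fun x : SkorokhodSpace ℝ => x t) ⁻¹' Ici c = ⋂ (m : ℕ) (k : ℕ),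
      {x | ∃ s ∈ Ioo t (t + 1 / (m + 1)), c - 1 / ((k : ℝ) + 1) < x s} := by
    ext x
    simp only [mem_preimage, mem_Ici, mem_iInter, mem_ofPred_eq]
    have hx : Tendsto x (𝓝[>] t) (𝓝 (x t)) :=
      (x.right_continuous t).mono_left (nhdsWithin_mono _ Ioi_subset_Ici_self)
    constructor
    · intro hc m k
      have h1 : ∀ᶠ s in 𝓝[>] t, c - 1 / ((k : ℝ) + 1) < x s :=
        hx.eventually_const_lt (by linarith [Nat.one_div_pos_of_nat (α := ℝ) (n := k)])
      have h2 : ∀ᶠ s in 𝓝[>] t, s ∈ Ioo t (t + 1 / (m + 1)) :=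
        Ioo_mem_nhdsGT (lt_add_of_pos_right t (by positivity))
      obtain ⟨s, hs⟩ := (h2.and h1).exists
      exact ⟨s, hs⟩
    · intro h
      choose s hs hcs using fun m : ℕ => h m m
      have hst : Tendsto s atTop (𝓝[>] t) := by
        refine tendsto_nhdsWithin_iff.2 ⟨?_, Eventually.of_forall fun m => (hs m).1⟩
        refine tendsto_of_tendsto_of_tendsto_of_le_of_le tendsto_const_nhds
          (h := fun m : ℕ => t + 1 / ((m : ℝ≥0) + 1)) ?_ (fun m => (hs m).1.le) fun m => (hs m).2.le
        simpa using tendsto_const_nhds.add (tendsto_one_div_add_atTop_nhds_zero_nat (𝕜 := ℝ≥0))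
      have h1 : Tendsto (fun m : ℕ => c - 1 / ((m : ℝ) + 1)) atTop (𝓝 c) := by
        simpa using tendsto_const_nhds.sub (tendsto_one_div_add_atTop_nhds_zero_nat (𝕜 := ℝ))
      exact le_of_tendsto_of_tendsto' h1 (hx.comp hst) fun m => (hcs m).le
  rw [h]
  exact MeasurableSet.iInter fun m => MeasurableSet.iInter fun k =>
    (isOpen_setOf_exists_gt _ _ _).measurableSet

theorem measurable_eval_sample (m : ℕ) (q : ℝ≥0 → ℕ) (hq : Measurable q) :
    Measurable fun z : SkorokhodSpace ℝ × ℝ≥0 => z.1 ((q z.2 : ℝ≥0) / (m + 1)) := by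
  have h : Measurable fun z : SkorokhodSpace ℝ × ℕ => z.1 ((z.2 : ℝ≥0) / (m + 1)) :=
    measurable_from_prod_countable_left fun i => measurable_eval ((i : ℝ≥0) / (m + 1))
  exact h.comp (measurable_fst.prodMk (hq.comp measurable_snd))

theorem measurable_leftLim :
    Measurable fun z : SkorokhodSpace ℝ × ℝ≥0 => Function.leftLim z.1 z.2 := by
  refine measurable_of_tendsto_metrizable
    (f := fun (m : ℕ) z => z.1 (((⌈((m : ℝ≥0) + 1) * z.2⌉₊ - 1 : ℕ) : ℝ≥0) / (m + 1)))
    (fun m => measurable_eval_sample m (fun s => ⌈((m : ℝ≥0) + 1) * s⌉₊ - 1) (by fun_prop)) ?_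
  refine tendsto_pi_nhds.2 fun ⟨x, s⟩ => ?_
  simp only
  rcases eq_or_lt_of_le (zero_le (a := s)) with rfl | hs
  · rw [leftLim_eq_of_eq_bot _ (by rw [← NNReal.bot_eq_zero, Iio_bot, nhdsWithin_empty])]
    simp
  · have hlt : ∀ m : ℕ, ((⌈((m : ℝ≥0) + 1) * s⌉₊ - 1 : ℕ) : ℝ≥0) / (m + 1) < s := by
      intro m
      have hm : (0 : ℝ≥0) < m + 1 := by positivity
      rw [div_lt_iff₀ hm, mul_comm]
      exact Nat.lt_ceil.1 (Nat.sub_one_lt (Nat.ceil_pos.2 (by positivity)).ne')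
    have : (𝓝[<] s).NeBot := nhdsLT_neBot_of_exists_lt ⟨0, hs⟩
    refine (tendsto_leftLim_of_tendsto (x.left_limits s)).comp (tendsto_nhdsWithin_iff.2 ⟨?_, ?_⟩)
    · have h1 : Tendsto (fun m : ℕ => s - 1 / ((m : ℝ≥0) + 1)) atTop (𝓝 s) := by
        simpa using tendsto_const_nhds.sub (tendsto_one_div_add_atTop_nhds_zero_nat (𝕜 := ℝ≥0))
      refine tendsto_of_tendsto_of_tendsto_of_le_of_le h1 tendsto_const_nhds (fun m => ?_)
        fun m => ?_
      · have hm : (0 : ℝ≥0) < m + 1 := by positivity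
        rw [tsub_le_iff_right, ← add_div, le_div_iff₀ hm, mul_comm]
        refine (Nat.le_ceil _).trans ?_
        exact_mod_cast le_tsub_add (a := 1)
      · exact (hlt m).le
    · exact Eventually.of_forall hlt

theorem measurable_eval_uncurry :
    Measurable fun z : SkorokhodSpace ℝ × ℝ≥0 => z.1 z.2 := by
  refine measurable_of_tendsto_metrizable
    (f := fun (m : ℕ) z => z.1 (((⌊((m : ℝ≥0) + 1) * z.2⌋₊ + 1 : ℕ) : ℝ≥0) / (m + 1)))
    (fun m => measurable_eval_sample m (fun s => ⌊((m : ℝ≥0) + 1) * s⌋₊ + 1) (by fun_prop)) ?_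
  refine tendsto_pi_nhds.2 fun ⟨x, s⟩ => ?_
  have hx : Tendsto x (𝓝[≥] s) (𝓝 (x s)) := x.right_continuous s
  have hle : ∀ m : ℕ, s ≤ ((⌊((m : ℝ≥0) + 1) * s⌋₊ + 1 : ℕ) : ℝ≥0) / (m + 1) := by
    intro m
    have hm : (0 : ℝ≥0) < m + 1 := by positivity
    rw [le_div_iff₀ hm, mul_comm]
    exact_mod_cast (Nat.lt_floor_add_one _).le
  refine hx.comp (tendsto_nhdsWithin_iff.2 ⟨?_, Eventually.of_forall hle⟩)
  have h1 : Tendsto (fun m : ℕ => s + 1 / ((m : ℝ≥0) + 1)) atTop (𝓝 s) := by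
    simpa using tendsto_const_nhds.add (tendsto_one_div_add_atTop_nhds_zero_nat (𝕜 := ℝ≥0))
  refine tendsto_of_tendsto_of_tendsto_of_le_of_le tendsto_const_nhds h1 hle fun m => ?_
  have hm : (0 : ℝ≥0) < m + 1 := by positivity
  rw [Nat.cast_add, Nat.cast_one, add_div]
  gcongr
  rw [div_le_iff₀ hm, mul_comm s]
  exact Nat.floor_le zero_le

end SkorokhodSpace

namespace LocFinMeasure

theorem measurable_apply {B : Set (ℝ≥0 × ℝ≥0)} (hB : MeasurableSet B) :
    Measurable fun μ : LocFinMeasure => μ.toMeasure B := by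
  refine Measurable.of_comap_le ?_
  exact le_iSup₂_of_le B hB le_rfl

/-- The measure of a section depends measurably on the point and on the measure. -/
theorem measurable_section {α : Type*} [MeasurableSpace α] {κ : α → LocFinMeasure}
    (hκ : Measurable κ) {A : Set (α × (ℝ≥0 × ℝ≥0))} (hA : MeasurableSet A) :
    Measurable fun a => (κ a).toMeasure (Prod.mk a ⁻¹' A) := by
  let K : ℕ → Set (ℝ≥0 × ℝ≥0) := compactCovering (ℝ≥0 × ℝ≥0)
  have hK : ∀ n, IsCompact (K n) := isCompact_compactCovering _
  let κ' : ℕ → Kernel α (ℝ≥0 × ℝ≥0) := fun n =>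
    { toFun := fun a => (κ a).toMeasure.restrict (K n)
      measurable' := Measure.measurable_of_measurable_coe _ fun B hB => by
        simp only [Measure.restrict_apply hB]
        exact (measurable_apply (hB.inter (hK n).measurableSet)).comp hκ }
  have hsec : ∀ a, MeasurableSet (Prod.mk a ⁻¹' A) := fun a => measurable_prodMk_left hA
  have h : ∀ a, (κ a).toMeasure (Prod.mk a ⁻¹' A) = ⨆ n, κ' n a (Prod.mk a ⁻¹' A) := by
    intro a
    have h1 : ∀ n, κ' n a (Prod.mk a ⁻¹' A) = (κ a).toMeasure (Prod.mk a ⁻¹' A ∩ K n) :=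
      fun n => Measure.restrict_apply (hsec a)
    simp_rw [h1]
    rw [← Monotone.measure_iUnion, ← inter_iUnion, iUnion_compactCovering, inter_univ]
    exact fun i j hij => inter_subset_inter_right _ (compactCovering_subset _ hij)
  simp_rw [h]
  refine Measurable.iSup fun n => Kernel.measurable_kernel_prodMk_left_of_finite hA fun a => ?_
  exact ⟨by
    change (κ a).toMeasure.restrict (K n) univ < ∞
    rw [Measure.restrict_apply_univ]
    exact (hK n).measure_lt_top⟩

end LocFinMeasure

theorem measurable_thinning_apply {Ω : Type*} [MeasurableSpace Ω] {Y : Ω → SkorokhodSpace ℝ}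
    {π : Ω → SimplePointMeasure} (hY : Measurable Y) (hπ : Measurable π) (t : ℝ≥0) :
    Measurable fun ω => thinning (Y ω) (π ω) t := by
  have hA : MeasurableSet {z : Ω × (ℝ≥0 × ℝ≥0) |
      z.2.1 ≤ t ∧ (z.2.2 : ℝ) ≤ Function.leftLim (Y z.1) z.2.1} := by
    have h1 : MeasurableSet {z : Ω × (ℝ≥0 × ℝ≥0) | z.2.1 ≤ t} :=
      measurableSet_le measurable_snd.fst measurable_const
    have h2 : MeasurableSet {z : Ω × (ℝ≥0 × ℝ≥0) |
        (z.2.2 : ℝ) ≤ Function.leftLim (Y z.1) z.2.1} :=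
      measurableSet_le measurable_snd.snd.coe_nnreal_real
        (measurable_leftLim.comp ((hY.comp measurable_fst).prodMk measurable_snd.fst))
    exact h1.inter h2
  have h := LocFinMeasure.measurable_section (measurable_subtype_coe.comp hπ) hA
  have h' : (fun ω => thinning (Y ω) (π ω) t) =
      fun ω => ((π ω).1.toMeasure (thinningSet (Y ω) t)).toReal :=
    funext fun ω => thinningValue_eq _ _ _
  rw [h']
  exact h.ennreal_toReal

/-! ### The completed graph of a path has zero area -/

namespace SkorokhodSpace

/-- Strict inequalities of the same sense at both ends `x (t-)` and `x t` persist in a neighbourhood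
of `t`, so that the point is away from the completed graph. -/
theorem avoids_of_lt (x : SkorokhodSpace ℝ) (p : ℝ≥0 × ℝ≥0)
    (h : ((p.2 : ℝ) < Function.leftLim x p.1 ∧ (p.2 : ℝ) < x p.1) ∨
      (Function.leftLim x p.1 < p.2 ∧ x p.1 < p.2)) : x.Avoids p := by
  have hl := tendsto_leftLim_of_tendsto (x.left_limits p.1)
  have hr : Tendsto x (𝓝[≥] p.1) (𝓝 (x p.1)) := x.right_continuous p.1
  rcases h with ⟨h1, h2⟩ | ⟨h1, h2⟩
  · obtain ⟨c, hc, hc'⟩ := exists_between (lt_min h1 h2)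
    have h3 : ∀ᶠ u in 𝓝 p.1, c < x u := by
      rw [← nhdsLT_sup_nhdsGE]
      exact eventually_sup.2 ⟨hl.eventually_const_lt (hc'.trans_le (min_le_left _ _)),
        hr.eventually_const_lt (hc'.trans_le (min_le_right _ _))⟩
    obtain ⟨ε, hε, h4⟩ := Metric.eventually_nhds_iff.1 h3
    refine ⟨min ε (c - p.2), lt_min hε (sub_pos.2 hc), Or.inl fun u hu => ?_⟩
    linarith [h4 (hu.trans_le (min_le_left _ _)), min_le_right ε (c - p.2)]
  · obtain ⟨c, hc, hc'⟩ := exists_between (max_lt h1 h2)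
    have h3 : ∀ᶠ u in 𝓝 p.1, x u < c := by
      rw [← nhdsLT_sup_nhdsGE]
      exact eventually_sup.2 ⟨hl.eventually_lt_const ((le_max_left _ _).trans_lt hc),
        hr.eventually_lt_const ((le_max_right _ _).trans_lt hc)⟩
    obtain ⟨ε, hε, h4⟩ := Metric.eventually_nhds_iff.1 h3
    refine ⟨min ε (p.2 - c), lt_min hε (sub_pos.2 hc'), Or.inr fun u hu => ?_⟩
    linarith [h4 (hu.trans_le (min_le_left _ _)), min_le_right ε (p.2 - c)]

theorem countable_setOf_leftLim_ne (x : SkorokhodSpace ℝ) :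
    {s | Function.leftLim x s ≠ x s}.Countable := by
  choose F hF using fun m : ℕ =>
    x.exists_finset_dist_lt m (Nat.one_div_pos_of_nat (α := ℝ) (n := m))
  refine (countable_iUnion fun m => (F m).countable_toSet).mono fun s hs => ?_
  by_contra hsF
  simp only [mem_iUnion, not_exists, Finset.mem_coe] at hsF
  refine hs ?_
  by_cases hbot : 𝓝[<] s = ⊥
  · exact leftLim_eq_of_eq_bot _ hbot
  have : (𝓝[<] s).NeBot := ⟨hbot⟩
  have hl := tendsto_leftLim_of_tendsto (x.left_limits s)
  refine dist_le_zero.1 (ge_of_tendsto (tendsto_one_div_add_atTop_nhds_zero_nat (𝕜 := ℝ)) ?_)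
  obtain ⟨k, hk⟩ := exists_nat_ge s
  filter_upwards [eventually_ge_atTop k] with m hm
  have h1 : ∀ᶠ u in 𝓝[<] s, ∀ f ∈ F m, f ≤ s ↔ f ≤ u := by
    refine (eventually_all_finset _).2 fun f hf => ?_
    rcases lt_trichotomy f s with hfs | rfl | hfs
    · filter_upwards [Ioo_mem_nhdsLT hfs] with u hu using iff_of_true hfs.le hu.1.le
    · exact absurd hf (hsF m)
    · filter_upwards [self_mem_nhdsWithin] with u hu
      exact iff_of_false (not_le.2 hfs) (not_le.2 (lt_trans hu hfs))
  refine le_of_tendsto (hl.dist tendsto_const_nhds) (h1.mono fun u hu => ?_)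
  rw [dist_comm]
  exact (hF m s (hk.trans (by exact_mod_cast hm)) u hu).le

/-- The pairs of a path and a point lying on its completed graph. -/
def completedGraph : Set (SkorokhodSpace ℝ × (ℝ≥0 × ℝ≥0)) :=
  {z | ¬(((z.2.2 : ℝ) < Function.leftLim z.1 z.2.1 ∧ (z.2.2 : ℝ) < z.1 z.2.1) ∨
    (Function.leftLim z.1 z.2.1 < z.2.2 ∧ z.1 z.2.1 < z.2.2))}

theorem measurableSet_completedGraph : MeasurableSet completedGraph := by
  have hl : Measurable fun z : SkorokhodSpace ℝ × (ℝ≥0 × ℝ≥0) => Function.leftLim z.1 z.2.1 :=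
    measurable_leftLim.comp (measurable_fst.prodMk measurable_snd.fst)
  have hr : Measurable fun z : SkorokhodSpace ℝ × (ℝ≥0 × ℝ≥0) => z.1 z.2.1 :=
    measurable_eval_uncurry.comp (measurable_fst.prodMk measurable_snd.fst)
  have hz : Measurable fun z : SkorokhodSpace ℝ × (ℝ≥0 × ℝ≥0) => (z.2.2 : ℝ) :=
    measurable_snd.snd.coe_nnreal_real
  exact (((measurableSet_lt hz hl).inter (measurableSet_lt hz hr)).union
    ((measurableSet_lt hl hz).inter (measurableSet_lt hr hz))).compl

end SkorokhodSpace

theorem lebesgueQuadrant_apply (A : Set (ℝ≥0 × ℝ≥0)) :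
    lebesgueQuadrant A = volume ((fun p : ℝ≥0 × ℝ≥0 => ((p.1 : ℝ), (p.2 : ℝ))) '' A) := by
  have h : MeasurableEmbedding ((↑) : ℝ≥0 → ℝ) := MeasurableEmbedding.subtype_coe measurableSet_Ici
  exact (h.prodMap h).comap_apply _ _

theorem lebesgueQuadrant_completedGraph (x : SkorokhodSpace ℝ) :
    lebesgueQuadrant (Prod.mk x ⁻¹' completedGraph) = 0 := by
  rw [lebesgueQuadrant_apply]
  let D : Set ℝ := (↑) '' {s : ℝ≥0 | Function.leftLim x s ≠ x s}
  let G : Set (ℝ × ℝ) := {p | p.2 = x p.1.toNNReal}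
  refine measure_mono_null (t := D ×ˢ univ ∪ G) ?_ (measure_union_null ?_ ?_)
  · rintro _ ⟨p, hp, rfl⟩
    by_cases hD : Function.leftLim x p.1 = x p.1
    · right
      simp only [completedGraph, mem_preimage, mem_ofPred_eq, hD, and_self, not_or, not_lt] at hp
      simp only [G, mem_ofPred_eq, Real.toNNReal_coe]
      exact le_antisymm hp.2 hp.1
    · exact Or.inl ⟨⟨p.1, hD, rfl⟩, mem_univ _⟩
  · rw [Measure.volume_eq_prod, Measure.prod_prod,
      (x.countable_setOf_leftLim_ne.image _).measure_zero, zero_mul]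
  · have hx : Measurable fun s : ℝ => x s.toNNReal :=
      measurable_eval_uncurry.comp (measurable_const.prodMk measurable_real_toNNReal)
    have hG : MeasurableSet G := measurableSet_eq_fun measurable_snd (hx.comp measurable_fst)
    rw [Measure.volume_eq_prod, Measure.measure_prod_null hG]
    refine Eventually.of_forall fun s => ?_
    have : Prod.mk s ⁻¹' G = {x s.toNNReal} := rfl
    simp [this]

/-! ### Poisson measures -/

theorem poissonMeasure_compl_le (r : ℝ≥0) (s : Finset ℕ) {c : ℝ≥0}
    (h : 1 - (c : ℝ) ≤ ∑ j ∈ s, Real.exp (-r) * r ^ j / j.factorial) :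
    poissonMeasure r (s : Set ℕ)ᶜ ≤ c := by
  rw [← ENNReal.toReal_le_toReal (measure_ne_top _ _) ENNReal.coe_ne_top, ← measureReal_def,
    probReal_compl_eq_one_sub s.measurableSet, ENNReal.coe_toReal, ← sum_measureReal_singleton]
  simp only [poissonMeasure_real_singleton]
  linarith

namespace IsPoissonMeasure

variable {Ω : Type*} [MeasurableSpace Ω] {π : Ω → LocFinMeasure} {ν : Measure (ℝ≥0 × ℝ≥0)}
  {P : Measure Ω}

theorem measure_setOf_mem (hπ : IsPoissonMeasure π ν P) {B : Set (ℝ≥0 × ℝ≥0)}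
    (hB : MeasurableSet B) (hν : ν B ≠ ∞) {S : Set ℝ≥0∞} (hS : MeasurableSet S) :
    P {ω | (π ω).toMeasure B ∈ S} = poissonMeasure (ν B).toNNReal {j | (j : ℝ≥0∞) ∈ S} := by
  have h := congrArg (fun Q : Measure ℝ≥0∞ => Q S) (hπ.law_of_ne_top B hB hν)
  have hm : Measurable fun ω => (π ω).toMeasure B :=
    (LocFinMeasure.measurable_apply hB).comp hπ.measurable
  rwa [Measure.map_apply hm hS,
    Measure.map_apply (measurable_of_countable _) hS] at h

theorem measure_ne_zero_le (hπ : IsPoissonMeasure π ν P) {B : Set (ℝ≥0 × ℝ≥0)}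
    (hB : MeasurableSet B) : P {ω | (π ω).toMeasure B ≠ 0} ≤ ν B := by
  by_cases hν : ν B = ∞
  · simp [hν]
  have h := hπ.measure_setOf_mem hB hν (S := {0}ᶜ) (measurableSet_singleton 0).compl
  have h' : {j : ℕ | (j : ℝ≥0∞) ∈ ({0}ᶜ : Set ℝ≥0∞)} = (({0} : Finset ℕ) : Set ℕ)ᶜ := by
    ext j
    simp
  rw [h'] at h
  refine (le_of_eq h).trans ((poissonMeasure_compl_le (ν B).toNNReal {0}
    (c := (ν B).toNNReal) ?_).trans (le_of_eq (ENNReal.coe_toNNReal hν)))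
  have := Real.add_one_le_exp (-((ν B).toNNReal : ℝ))
  simp only [Finset.sum_singleton, pow_zero, mul_one, Nat.factorial_zero, Nat.cast_one, div_one]
  linarith

theorem measure_one_lt_le (hπ : IsPoissonMeasure π ν P) {B : Set (ℝ≥0 × ℝ≥0)}
    (hB : MeasurableSet B) : P {ω | 1 < (π ω).toMeasure B} ≤ ν B ^ 2 := by
  by_cases hν : ν B = ∞
  · simp [hν]
  have h := hπ.measure_setOf_mem hB hν (S := Ioi 1) measurableSet_Ioi
  have h' : {j : ℕ | (j : ℝ≥0∞) ∈ Ioi (1 : ℝ≥0∞)} = (({0, 1} : Finset ℕ) : Set ℕ)ᶜ := by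
    ext j
    simp only [mem_Ioi, Nat.one_lt_cast, mem_ofPred_eq, Finset.coe_insert, Finset.coe_singleton,
      mem_compl_iff, mem_insert_iff, mem_singleton_iff]
    omega
  rw [h'] at h
  refine (le_of_eq h).trans ((poissonMeasure_compl_le (ν B).toNNReal {0, 1}
    (c := (ν B).toNNReal ^ 2) ?_).trans (le_of_eq ?_))
  · have h1 := Real.add_one_le_exp (-((ν B).toNNReal : ℝ))
    have h2 : (0 : ℝ) ≤ (ν B).toNNReal := NNReal.coe_nonneg _
    rw [Finset.sum_pair zero_ne_one]
    simp only [pow_zero, mul_one, Nat.factorial_zero, Nat.cast_one, div_one, pow_one,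
      Nat.factorial_one, NNReal.coe_pow]
    nlinarith
  · rw [ENNReal.coe_pow, ENNReal.coe_toNNReal hν]

theorem ae_eq_zero (hπ : IsPoissonMeasure π ν P) {B : Set (ℝ≥0 × ℝ≥0)}
    (hB : MeasurableSet B) (hν : ν B = 0) : ∀ᵐ ω ∂P, (π ω).toMeasure B = 0 :=
  measure_mono_null (fun _ h => h) (le_antisymm ((hπ.measure_ne_zero_le hB).trans hν.le) zero_le)

end IsPoissonMeasure

/-! ### Almost sure regularity of Poisson configurations -/

section Regular

variable {Ω : Type*} [MeasurableSpace Ω] {P : Measure Ω}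

/-- By independence and Fubini, a Poisson measure almost surely does not charge the completed graph
of an independent path, as this graph has zero area. -/
theorem ae_avoids [IsProbabilityMeasure P] {Y : Ω → SkorokhodSpace ℝ} {π : Ω → SimplePointMeasure}
    (hY : Measurable Y) (hπ : IsPoissonMeasure (fun ω => (π ω).1) lebesgueQuadrant P)
    (hind : IndepFun Y π P) : ∀ᵐ ω ∂P, ∀ p ∈ (π ω).atoms, (Y ω).Avoids p := by
  have hπm : Measurable π := hπ.measurable.subtype_mk
  let G : Set (SkorokhodSpace ℝ × SimplePointMeasure) :=
    {z | z.2.1.toMeasure (Prod.mk z.1 ⁻¹' completedGraph) = 0}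
  have hG : MeasurableSet G := by
    have hA : MeasurableSet {w : (SkorokhodSpace ℝ × SimplePointMeasure) × (ℝ≥0 × ℝ≥0) |
        (w.1.1, w.2) ∈ completedGraph} :=
      (measurable_fst.fst.prodMk measurable_snd) measurableSet_completedGraph
    exact (LocFinMeasure.measurable_section (measurable_subtype_coe.comp measurable_snd) hA)
      (measurableSet_singleton 0)
  have h1 : ∀ᵐ z ∂(P.map Y).prod (P.map π), z ∈ G := by
    have : IsProbabilityMeasure (P.map π) := Measure.isProbabilityMeasure_map hπm.aemeasurable
    rw [Measure.ae_prod_mem_iff_ae_ae_mem hG]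
    refine Eventually.of_forall fun x => ?_
    have hGx : MeasurableSet {μ | (x, μ) ∈ G} := measurable_prodMk_left hG
    rw [ae_map_iff hπm.aemeasurable hGx]
    exact hπ.ae_eq_zero (measurable_prodMk_left measurableSet_completedGraph)
      (lebesgueQuadrant_completedGraph x)
  rw [← (indepFun_iff_map_prod_eq_prod_map_map hY.aemeasurable hπm.aemeasurable).1 hind] at h1
  filter_upwards [(ae_map_iff (hY.prodMk hπm).aemeasurable hG).1 h1] with ω hω p hp
  refine avoids_of_lt _ _ (by_contra fun hne => hp ?_)
  exact measure_mono_null (singleton_subset_iff.2 hne) hω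

theorem ae_time_ne_zero {π : Ω → SimplePointMeasure}
    (hπ : IsPoissonMeasure (fun ω => (π ω).1) lebesgueQuadrant P) :
    ∀ᵐ ω ∂P, ∀ p ∈ (π ω).atoms, p.1 ≠ 0 := by
  have hB : MeasurableSet (({0} : Set ℝ≥0) ×ˢ (univ : Set ℝ≥0)) :=
    (measurableSet_singleton 0).prod MeasurableSet.univ
  have hν : lebesgueQuadrant (({0} : Set ℝ≥0) ×ˢ (univ : Set ℝ≥0)) = 0 := by
    rw [lebesgueQuadrant_apply]
    refine measure_mono_null (t := ({0} : Set ℝ) ×ˢ univ) ?_ ?_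
    · rintro _ ⟨p, hp, rfl⟩
      have : p.1 = 0 := hp.1
      simp [this]
    · rw [Measure.volume_eq_prod, Measure.prod_prod]
      simp
  filter_upwards [hπ.ae_eq_zero hB hν] with ω hω p hp hp0
  have hpB : p ∈ ({0} : Set ℝ≥0) ×ˢ (univ : Set ℝ≥0) := ⟨hp0, mem_univ _⟩
  exact hp (measure_mono_null (singleton_subset_iff.2 hpB) hω)

/-- The `i`-th vertical strip of width `1 / (m + 1)`, cut at height `R`. -/
def strip (R m i : ℕ) : Set (ℝ≥0 × ℝ≥0) :=
  Ico ((i : ℝ≥0) / (m + 1)) ((i + 1) / (m + 1)) ×ˢ Iio (R : ℝ≥0)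

theorem measurableSet_strip (R m i : ℕ) : MeasurableSet (strip R m i) :=
  measurableSet_Ico.prod measurableSet_Iio

theorem lebesgueQuadrant_strip_le (R m i : ℕ) :
    lebesgueQuadrant (strip R m i) ≤ ENNReal.ofReal (R / (m + 1)) := by
  rw [lebesgueQuadrant_apply]
  have hsub : (fun p : ℝ≥0 × ℝ≥0 => ((p.1 : ℝ), (p.2 : ℝ))) '' strip R m i ⊆
      Icc ((i : ℝ) / (m + 1)) ((i + 1) / (m + 1)) ×ˢ Icc 0 (R : ℝ) := by
    rintro _ ⟨p, ⟨⟨h1, h2⟩, h3⟩, rfl⟩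
    have h1' := NNReal.coe_le_coe.2 h1
    have h2' := NNReal.coe_le_coe.2 h2.le
    have h3' := NNReal.coe_le_coe.2 (le_of_lt h3)
    push_cast at h1' h2' h3'
    exact ⟨⟨h1', h2'⟩, p.2.2, h3'⟩
  refine (measure_mono hsub).trans (le_of_eq ?_)
  rw [Measure.volume_eq_prod, Measure.prod_prod, Real.volume_Icc, Real.volume_Icc,
    ← ENNReal.ofReal_mul (by rw [← sub_div]; simp; positivity)]
  congr 1
  field_simp
  ring

/-- Points with equal time coordinates lie in a common strip. Since a square is covered by `O(m)`
strips of area `O(1 / m)`, events that have for each strip a probability of at most the squared area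
occur with probability `O(1 / m)`, hence almost never. -/
theorem ae_time_ne_of_measure_le_sq {S S' : Ω → Set (ℝ≥0 × ℝ≥0)}
    {r : ℝ≥0 × ℝ≥0 → ℝ≥0 × ℝ≥0 → Prop}
    (h : ∀ R m i, P {ω | ∃ p ∈ S ω ∩ strip R m i, ∃ q ∈ S' ω ∩ strip R m i, r p q} ≤
      lebesgueQuadrant (strip R m i) ^ 2) :
    ∀ᵐ ω ∂P, ∀ p ∈ S ω, ∀ q ∈ S' ω, p.1 = q.1 → ¬ r p q := by
  let E : ℕ → ℕ → ℕ → Set Ω := fun R m i =>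
    {ω | ∃ p ∈ S ω ∩ strip R m i, ∃ q ∈ S' ω ∩ strip R m i, r p q}
  have h0 : ∀ R, P (⋂ m, ⋃ i ∈ Finset.range (R * (m + 1)), E R m i) = 0 := by
    intro R
    have hb : ∀ m : ℕ, P (⋂ m, ⋃ i ∈ Finset.range (R * (m + 1)), E R m i) ≤
        ENNReal.ofReal ((R : ℝ) ^ 3 * (1 / ((m : ℝ) + 1))) := by
      intro m
      calc _ ≤ P (⋃ i ∈ Finset.range (R * (m + 1)), E R m i) := measure_mono (iInter_subset _ m)
        _ ≤ ∑ i ∈ Finset.range (R * (m + 1)), P (E R m i) := measure_biUnion_finset_le _ _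
        _ ≤ ∑ i ∈ Finset.range (R * (m + 1)), ENNReal.ofReal (R / (m + 1)) ^ 2 := by
          refine Finset.sum_le_sum fun i _ => (h R m i).trans ?_
          gcongr
          exact lebesgueQuadrant_strip_le R m i
        _ = _ := by
          rw [Finset.sum_const, Finset.card_range, nsmul_eq_mul,
            ← ENNReal.ofReal_pow (by positivity), ← ENNReal.ofReal_natCast,
            ← ENNReal.ofReal_mul (by positivity)]
          congr 1
          push_cast
          field_simp
    have ht : Tendsto (fun m : ℕ => ENNReal.ofReal ((R : ℝ) ^ 3 * (1 / ((m : ℝ) + 1)))) atTop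
        (𝓝 0) := by
      have := (tendsto_one_div_add_atTop_nhds_zero_nat (𝕜 := ℝ)).const_mul ((R : ℝ) ^ 3)
      simpa using ENNReal.tendsto_ofReal this
    exact le_antisymm (ge_of_tendsto' ht hb) zero_le
  refine measure_mono_null ?_ (measure_iUnion_null h0)
  intro ω hω
  simp only [mem_compl_iff, mem_ofPred_eq, not_forall, not_not] at hω
  obtain ⟨p, hp, q, hq, hpq, hr⟩ := hω
  obtain ⟨R, hR⟩ := exists_nat_gt (max p.1 (max p.2 q.2))
  obtain ⟨hR1, hR2, hR3⟩ : p.1 < R ∧ p.2 < R ∧ q.2 < R := by simpa using hR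
  refine mem_iUnion.2 ⟨R, mem_iInter.2 fun m => ?_⟩
  have hm : (0 : ℝ≥0) < m + 1 := by positivity
  have hi : p.1 ∈ Ico ((⌊((m : ℝ≥0) + 1) * p.1⌋₊ : ℝ≥0) / (m + 1))
      (((⌊((m : ℝ≥0) + 1) * p.1⌋₊ : ℝ≥0) + 1) / (m + 1)) := by
    constructor
    · rw [div_le_iff₀ hm, mul_comm p.1]
      exact Nat.floor_le zero_le
    · rw [lt_div_iff₀ hm, mul_comm p.1]
      exact Nat.lt_floor_add_one _
  refine mem_biUnion (x := ⌊((m : ℝ≥0) + 1) * p.1⌋₊) ?_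
    ⟨p, ⟨hp, hi, hR2⟩, q, ⟨hq, hpq ▸ hi, hR3⟩, hr⟩
  simp only [Finset.coe_range, mem_Iio]
  rw [Nat.floor_lt zero_le]
  push_cast
  rw [mul_comm]
  gcongr

/-- Almost surely no two atoms share their time: two atoms in a thin strip have probability of the
order of its squared area. -/
theorem ae_time_injective {π : Ω → SimplePointMeasure}
    (hπ : IsPoissonMeasure (fun ω => (π ω).1) lebesgueQuadrant P) :
    ∀ᵐ ω ∂P, ∀ p ∈ (π ω).atoms, ∀ q ∈ (π ω).atoms, p.1 = q.1 → p = q := by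
  have h := ae_time_ne_of_measure_le_sq (P := P) (S := fun ω => (π ω).atoms)
    (S' := fun ω => (π ω).atoms) (r := fun p q => p ≠ q) fun R m i => ?_
  · filter_upwards [h] with ω hω p hp q hq hpq using not_not.1 (hω p hp q hq hpq)
  · refine (measure_mono ?_).trans (hπ.measure_one_lt_le (measurableSet_strip R m i))
    rintro ω ⟨p, hp, q, hq, hpq⟩
    rw [mem_ofPred_eq, toMeasure_apply, ← ENat.toENNReal_one, ENat.toENNReal_lt,
      Set.one_lt_encard_iff]
    exact ⟨p, q, hp, hq, hpq⟩

theorem ae_time_ne_of_indepFun {π π' : Ω → SimplePointMeasure}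
    (hπ : IsPoissonMeasure (fun ω => (π ω).1) lebesgueQuadrant P)
    (hπ' : IsPoissonMeasure (fun ω => (π' ω).1) lebesgueQuadrant P) (hind : IndepFun π π' P) :
    ∀ᵐ ω ∂P, ∀ p ∈ (π ω).atoms, ∀ q ∈ (π' ω).atoms, p.1 ≠ q.1 := by
  have h := ae_time_ne_of_measure_le_sq (P := P) (S := fun ω => (π ω).atoms)
    (S' := fun ω => (π' ω).atoms) (r := fun _ _ => True) fun R m i => ?_
  · filter_upwards [h] with ω hω p hp q hq hpq using hω p hp q hq hpq trivial
  · have hB := measurableSet_strip R m i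
    have hm : MeasurableSet {μ : SimplePointMeasure | μ.1.toMeasure (strip R m i) ≠ 0} :=
      ((LocFinMeasure.measurable_apply hB).comp measurable_subtype_coe)
        (measurableSet_singleton 0).compl
    have h1 := hind.measure_inter_preimage_eq_mul _ _ hm hm
    rw [sq]
    refine (measure_mono ?_).trans ((le_of_eq h1).trans
      (mul_le_mul' (hπ.measure_ne_zero_le hB) (hπ'.measure_ne_zero_le hB)))
    rintro ω ⟨p, hp, q, hq, -⟩
    exact ⟨fun h0 => hp.1 (measure_mono_null (singleton_subset_iff.2 hp.2) h0),
      fun h0 => hq.1 (measure_mono_null (singleton_subset_iff.2 hq.2) h0)⟩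

theorem ae_isRegularConfiguration [IsProbabilityMeasure P] {Y : ℕ → Ω → SkorokhodSpace ℝ}
    {π : ℕ → Ω → SimplePointMeasure} (hY : ∀ k, Measurable (Y k))
    (hπ : ∀ k, IsPoissonMeasure (fun ω => (π k ω).1) lebesgueQuadrant P)
    (hπ_indep : iIndepFun π P) (hindep : ∀ k, IndepFun (Y k) (π k) P) (n : ℕ) :
    ∀ᵐ ω ∂P, IsRegularConfiguration (fun k : Fin n => Y k ω) fun k : Fin n => π k ω := by
  have h1 : ∀ᵐ ω ∂P, ∀ k, ∀ p ∈ (π k ω).atoms, (Y k ω).Avoids p :=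
    ae_all_iff.2 fun k => ae_avoids (hY k) (hπ k) (hindep k)
  have h2 : ∀ᵐ ω ∂P, ∀ k, ∀ p ∈ (π k ω).atoms, p.1 ≠ 0 :=
    ae_all_iff.2 fun k => ae_time_ne_zero (hπ k)
  have h3 : ∀ᵐ ω ∂P, ∀ k, ∀ p ∈ (π k ω).atoms, ∀ q ∈ (π k ω).atoms, p.1 = q.1 → p = q :=
    ae_all_iff.2 fun k => ae_time_injective (hπ k)
  have h4 : ∀ᵐ ω ∂P, ∀ k l, k ≠ l → ∀ p ∈ (π k ω).atoms, ∀ q ∈ (π l ω).atoms, p.1 ≠ q.1 := by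
    refine ae_all_iff.2 fun k => ae_all_iff.2 fun l => ?_
    by_cases hkl : k = l
    · exact Eventually.of_forall fun ω h => absurd hkl h
    · exact (ae_time_ne_of_indepFun (hπ k) (hπ l) (hπ_indep.indepFun hkl)).mono fun ω h _ => h
  filter_upwards [h1, h2, h3, h4] with ω h1 h2 h3 h4
  refine ⟨fun k => h1 k, fun k => h2 k, fun k l p hp q hq hpq => ?_⟩
  by_cases hkl : k = l
  · subst hkl
    exact ⟨rfl, h3 k p hp q hq hpq⟩
  · exact absurd hpq (h4 k l (fun h => hkl (Fin.ext h)) p hp q hq)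

end Regular

/-! ### Mapping theorem for convergence in law -/

namespace TendstoInLaw

variable {Ω Ω' : Type*} [MeasurableSpace Ω] [MeasurableSpace Ω'] {P : Measure Ω}
  [IsProbabilityMeasure P] {P' : Measure Ω'} [IsProbabilityMeasure P']

theorem continuous_comp {ι E F : Type*} [TopologicalSpace E] [TopologicalSpace F] {l : Filter ι}
    {X : ι → Ω → E} {Z : Ω' → E} (h : TendstoInLaw X l Z P P') {g : E → F} (hg : Continuous g) :
    TendstoInLaw (fun i ω => g (X i ω)) l (fun ω => g (Z ω)) P P' := by
  let : MeasurableSpace E := borel E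
  have : BorelSpace E := ⟨rfl⟩
  let : MeasurableSpace F := borel F
  have : BorelSpace F := ⟨rfl⟩
  exact TendstoInDistribution.continuous_comp hg h

/-- Convergence in law follows from an upper bound on closed sets. -/
theorem of_forall_isClosed {E : Type*} [TopologicalSpace E] {X : ℕ → Ω → E} {Z : Ω' → E}
    (hX : ∀ N, Measurable[_, borel E] (X N)) (hZ : Measurable[_, borel E] Z)
    (h : ∀ F, IsClosed F → limsup (fun N => P (X N ⁻¹' F)) atTop ≤ P' (Z ⁻¹' F)) :
    TendstoInLaw X atTop Z P P' := by
  let : MeasurableSpace E := borel E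
  have : BorelSpace E := ⟨rfl⟩
  refine ⟨fun N => (hX N).aemeasurable, hZ.aemeasurable, ?_⟩
  refine tendsto_of_forall_isClosed_limsup_le' fun F hF => ?_
  simp only [ProbabilityMeasure.coe_mk]
  simp_rw [Measure.map_apply (hX _) hF.measurableSet, Measure.map_apply hZ hF.measurableSet]
  exact h F hF

theorem limsup_le {E : Type*} [TopologicalSpace E] [TopologicalSpace.PseudoMetrizableSpace E]
    {X : ℕ → Ω → E} {Z : Ω' → E} (h : TendstoInLaw X atTop Z P P') {F : Set E} (hF : IsClosed F) :
    limsup (fun N => P (X N ⁻¹' F)) atTop ≤ P' (Z ⁻¹' F) := by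
  let : MeasurableSpace E := borel E
  have : BorelSpace E := ⟨rfl⟩
  have h' : TendstoInDistribution X atTop Z (fun _ => P) P' := h
  have h1 := ProbabilityMeasure.limsup_measure_closed_le_of_tendsto h'.tendsto hF
  simp only [ProbabilityMeasure.coe_mk] at h1
  simp_rw [Measure.map_apply_of_aemeasurable (h'.forall_aemeasurable _) hF.measurableSet,
    Measure.map_apply_of_aemeasurable h'.aemeasurable_limit hF.measurableSet] at h1
  exact h1

/-- A mapping theorem: if `g (X N)` converges in law to `g Z` in a metrizable space, and if almost
surely `Φ` is sequentially continuous at `Z` for the topology induced by `g`, then `Φ (X N)`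
converges in law to `Φ Z`. -/
theorem of_ae_tendsto {S M E : Type*} [TopologicalSpace M]
    [TopologicalSpace.PseudoMetrizableSpace M] [TopologicalSpace E]
    {X : ℕ → Ω → S} {Z : Ω' → S} {g : S → M} {Φ : S → E}
    (h : TendstoInLaw (fun N ω => g (X N ω)) atTop (fun ω => g (Z ω)) P P')
    (hX : ∀ N, Measurable[_, borel E] fun ω => Φ (X N ω))
    (hZ : Measurable[_, borel E] fun ω => Φ (Z ω))
    (hΦ : ∀ᵐ ω ∂P', ∀ s : ℕ → S, Tendsto (fun m => g (s m)) atTop (𝓝 (g (Z ω))) →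
      Tendsto (fun m => Φ (s m)) atTop (𝓝 (Φ (Z ω)))) :
    TendstoInLaw (fun N ω => Φ (X N ω)) atTop (fun ω => Φ (Z ω)) P P' := by
  refine of_forall_isClosed hX hZ fun F hF => ?_
  calc limsup (fun N => P ((fun ω => Φ (X N ω)) ⁻¹' F)) atTop
      ≤ limsup (fun N => P ((fun ω => g (X N ω)) ⁻¹' closure (g '' (Φ ⁻¹' F)))) atTop :=
        limsup_le_limsup (Eventually.of_forall fun N => measure_mono fun ω hω =>
          subset_closure ⟨X N ω, hω, rfl⟩)
    _ ≤ P' ((fun ω => g (Z ω)) ⁻¹' closure (g '' (Φ ⁻¹' F))) := h.limsup_le isClosed_closure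
    _ ≤ P' ((fun ω => Φ (Z ω)) ⁻¹' F) := by
        refine measure_mono_ae ?_
        filter_upwards [hΦ] with ω hω hωF
        obtain ⟨u, hu, hlim⟩ := mem_closure_iff_seq_limit.1 hωF
        choose s hs hsu using hu
        refine hF.mem_of_tendsto (hω s ?_) (Eventually.of_forall hs)
        simpa only [hsu] using hlim

/-- Convergence in law in a countable product follows from that of the finite subfamilies. -/
theorem of_forall_fin {E : Type*} [TopologicalSpace E] [TopologicalSpace.PseudoMetrizableSpace E]
    {X : ℕ → Ω → ℕ → E} {Z : Ω' → ℕ → E}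
    (hX : ∀ N, Measurable[_, borel (ℕ → E)] (X N)) (hZ : Measurable[_, borel (ℕ → E)] Z)
    (h : ∀ n : ℕ, 1 ≤ n → TendstoInLaw (E := Fin n → E) (fun N ω k => X N ω k) atTop
      (fun ω k => Z ω k) P P') :
    TendstoInLaw X atTop Z P P' := by
  let : MeasurableSpace (ℕ → E) := borel _
  have : BorelSpace (ℕ → E) := ⟨rfl⟩
  refine of_forall_isClosed hX hZ fun F hF => ?_
  let r : (n : ℕ) → (ℕ → E) → Fin (n + 1) → E := fun n x k => x k
  have hr : ∀ n, Continuous (r n) := fun n => continuous_pi fun k => continuous_apply _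
  let C : (n : ℕ) → Set (Fin (n + 1) → E) := fun n => closure (r n '' F)
  have hC : ∀ n, IsClosed (r n ⁻¹' C n) := fun n => isClosed_closure.preimage (hr n)
  have hanti : Antitone fun n => r n ⁻¹' C n := by
    intro n m hnm x hx
    let ρ : (Fin (m + 1) → E) → Fin (n + 1) → E := fun y k =>
      y ⟨k, k.2.trans_le (Nat.succ_le_succ hnm)⟩
    have hρ : Continuous ρ := continuous_pi fun k => continuous_apply _
    have h1 : ρ (r m x) ∈ closure (ρ '' (r m '' F)) :=
      image_closure_subset_closure_image hρ ⟨_, hx, rfl⟩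
    rwa [image_image] at h1
  have hF' : ⋂ n, r n ⁻¹' C n = F := by
    refine Subset.antisymm (fun x hx => ?_)
      (subset_iInter fun n x hx => subset_closure ⟨x, hx, rfl⟩)
    rw [← hF.closure_eq]
    refine mem_closure_iff_nhds.2 fun s hs => ?_
    rw [nhds_pi, Filter.mem_pi'] at hs
    obtain ⟨I, t, ht, hts⟩ := hs
    -- all the indices that matter to the neighbourhood `s` are at most `I.sup id`
    have hx' : r (I.sup id) x ∈ C (I.sup id) := mem_iInter.1 hx (I.sup id)
    have hU : {y : Fin (I.sup id + 1) → E | ∀ k : Fin (I.sup id + 1), (k : ℕ) ∈ I → y k ∈ t k} ∈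
        𝓝 (r (I.sup id) x) := by
      refine eventually_all.2 fun k => ?_
      by_cases hk : (k : ℕ) ∈ I
      · have hk' : Tendsto (fun y : Fin (I.sup id + 1) → E => y k) (𝓝 (r (I.sup id) x)) (𝓝 (x k)) :=
          (continuous_apply k).tendsto _
        exact (hk'.eventually (ht k)).mono fun y hy _ => hy
      · exact Eventually.of_forall fun y h => absurd h hk
    obtain ⟨_, hfU, f, hf, rfl⟩ := mem_closure_iff_nhds.1 hx' _ hU
    exact ⟨f, hts fun i hi => hfU ⟨i, Nat.lt_succ_of_le (Finset.le_sup (f := id) hi)⟩ hi, hf⟩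
  have hlim : Tendsto (fun n => P' (Z ⁻¹' (r n ⁻¹' C n))) atTop (𝓝 (P' (Z ⁻¹' F))) := by
    rw [show Z ⁻¹' F = ⋂ n, Z ⁻¹' (r n ⁻¹' C n) by rw [← preimage_iInter, hF']]
    exact tendsto_measure_iInter_atTop
      (fun n => (hZ (hC n).measurableSet).nullMeasurableSet)
      (fun n m hnm => preimage_mono (hanti hnm)) ⟨0, measure_ne_top _ _⟩
  refine ge_of_tendsto' hlim fun n => ?_
  calc limsup (fun N => P (X N ⁻¹' F)) atTop
      ≤ limsup (fun N => P ((fun ω (k : Fin (n + 1)) => X N ω k) ⁻¹' C n)) atTop :=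
        limsup_le_limsup (Eventually.of_forall fun N => measure_mono fun ω hω =>
          subset_closure ⟨X N ω, hω, rfl⟩)
    _ ≤ P' ((fun ω (k : Fin (n + 1)) => Z ω k) ⁻¹' C n) :=
        (h (n + 1) (by omega)).limsup_le isClosed_closure

end TendstoInLaw

/-! ### Convergence of the thinnings -/

theorem measurable_vec_thinning {Ω : Type*} [MeasurableSpace Ω] {n : ℕ}
    {Y : Fin n → Ω → SkorokhodSpace ℝ} {π : Fin n → Ω → SimplePointMeasure}
    (hY : ∀ k, Measurable (Y k)) (hπ : ∀ k, Measurable (π k)) :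
    Measurable fun ω => vec fun k => thinning (Y k ω) (π k ω) :=
  measurable_of_eval fun t =>
    measurable_pi_lambda _ fun k => measurable_thinning_apply (hY k) (hπ k) t

/-- The families are indexed by `k : ℕ` (in place of `k ≥ 1`), and `N → ∞` along `ℕ`. -/
theorem theorem1 {Ω Ω' : Type*} [MeasurableSpace Ω] [MeasurableSpace Ω']
    (P : Measure Ω) [IsProbabilityMeasure P] (P' : Measure Ω') [IsProbabilityMeasure P']
    (Y : ℕ → ℕ → Ω → SkorokhodSpace ℝ) (Ybar : ℕ → Ω' → SkorokhodSpace ℝ)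
    (π : ℕ → Ω → SimplePointMeasure) (πbar : ℕ → Ω' → SimplePointMeasure)
    (hY : ∀ N k, Measurable (Y N k)) (hYbar : ∀ k, Measurable (Ybar k))
    (hY_nonneg : ∀ N k ω t, 0 ≤ Y N k ω t) (hYbar_nonneg : ∀ k ω t, 0 ≤ Ybar k ω t)
    (hπ : ∀ k, IsPoissonMeasure (fun ω => (π k ω).1) lebesgueQuadrant P)
    (hπbar : ∀ k, IsPoissonMeasure (fun ω => (πbar k ω).1) lebesgueQuadrant P')
    (hπ_indep : iIndepFun π P) (hπbar_indep : iIndepFun πbar P')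
    (hconv : ∀ n : ℕ, 1 ≤ n →
      TendstoInLaw (E := Fin n → SkorokhodSpace ℝ × SimplePointMeasure)
        (fun N ω k => (Y N k ω, π k ω)) atTop (fun ω k => (Ybar k ω, πbar k ω)) P P')
    (hindep : ∀ k, IndepFun (Ybar k) (πbar k) P') :
    (∀ n : ℕ, 1 ≤ n →
      TendstoInLaw (E := SkorokhodSpace (Fin n → ℝ))
        (fun N ω => SkorokhodSpace.vec fun k : Fin n => thinning (Y N k ω) (π k ω)) atTop
        (fun ω => SkorokhodSpace.vec fun k : Fin n => thinning (Ybar k ω) (πbar k ω)) P P') ∧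
    TendstoInLaw (E := ℕ → SkorokhodSpace ℝ)
      (fun N ω k => thinning (Y N k ω) (π k ω)) atTop
      (fun ω k => thinning (Ybar k ω) (πbar k ω)) P P' := by

  have hπm : ∀ k, Measurable (π k) := fun k => (hπ k).measurable.subtype_mk
  have hπbarm : ∀ k, Measurable (πbar k) := fun k => (hπbar k).measurable.subtype_mk
  have main : ∀ n : ℕ, 1 ≤ n →
      TendstoInLaw (E := SkorokhodSpace (Fin n → ℝ))
        (fun N ω => SkorokhodSpace.vec fun k : Fin n => thinning (Y N k ω) (π k ω)) atTop
        (fun ω => SkorokhodSpace.vec fun k : Fin n => thinning (Ybar k ω) (πbar k ω)) P P' := by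
    intro n hn
    -- the vague topology is replaced by a coarser one, induced by a map to a metrizable space
    let g : (Fin n → SkorokhodSpace ℝ × SimplePointMeasure) →
        Fin n → SkorokhodSpace ℝ × (ℕ × ℕ → ℝ) := fun s k => ((s k).1, (s k).2.testIntegrals)
    have hg : Continuous g := continuous_pi fun k =>
      ((continuous_apply k).fst).prodMk (continuous_testIntegrals.comp (continuous_apply k).snd)
    refine TendstoInLaw.of_ae_tendsto (g := g)
      (Φ := fun s : Fin n → SkorokhodSpace ℝ × SimplePointMeasure =>
        vec fun k => thinning (s k).1 (s k).2) ((hconv n hn).continuous_comp hg)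
      (fun N => measurable_vec_thinning (fun k => hY N k) fun k => hπm k)
      (measurable_vec_thinning (fun k => hYbar k) fun k => hπbarm k) ?_
    filter_upwards [ae_isRegularConfiguration hYbar hπbar hπbar_indep hindep n] with ω hω s hs
    have hs' := fun k => tendsto_pi_nhds.1 hs k
    exact hω.tendsto_vec_thinning (fun k => (continuous_fst.tendsto _).comp (hs' k))
      fun k => (continuous_snd.tendsto _).comp (hs' k)
  refine ⟨main, TendstoInLaw.of_forall_fin (fun N => ?_) ?_ fun n hn => ?_⟩
  · exact measurable_pi_of_eval fun k => measurable_thinning_apply (hY N k) (hπm k)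
  · exact measurable_pi_of_eval fun k => measurable_thinning_apply (hYbar k) (hπbarm k)
  · exact (main n hn).continuous_comp
      (g := fun z : SkorokhodSpace (Fin n → ℝ) => fun k => coord k z)
      (continuous_pi fun k => continuous_coord k)
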